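/- Let $k$ be an algebraically closed field and let $\mathsf T$ be a $k$-linear triangulated category with suspension functor $\Sigma$, with finite dimensional $\operatorname{Hom}$ spaces and split idempotents. Suppose that $\mathsf T$ has a Serre functor $S$, that is, an autoequivalence $S$ of $\mathsf T$ with natural $k$-linear isomorphisms $\mathsf T(A,B)\cong \operatorname{Hom}_k(\mathsf T(B,SA),k)$, and put $\tau=\Sigma^{-1}\circ S$ (the Auslander-Reiten translation). Let $\mathbb X$ be a class of objects of $\mathsf T$, closed under isomorphisms, (finite) direct sums, and direct summands. A morphism $M\to N$ is called an $\mathbb X$-monomorphism if each morphism $M\to X$ with $X$ in $\mathbb X$ factors through it, and an $\mathbb X$-epimorphism if each morphism $X\to N$ with $X$ in $\mathbb X$ factors through it. An $\mathbb X$-preenvelope of $M$ is an $\mathbb X$-monomorphism $M\to X_M$ with $X_M$ in $\mathbb X$; an $\mathbb X$-precover of $M$ is an $\mathbb X$-epimorphism $X^M\to M$ with $X^M$ in $\mathbb X$. Assume that $\mathbb X$ is preenveloping and precovering, that is, each object of $\mathsf T$ has an $\mathbb X$-preenvelope and an $\mathbb X$-precover. Let $\mathsf T_{\mathbb X}$ be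 the quotient category of $\mathsf T$ by the ideal of morphisms which factor through an object of $\mathbb X$; write $\underline\mu$ for the class of a morphism $\mu$. It carries the following pretriangulated structure. For each $M$ choose a preenvelope and a precover and complete them to distinguished triangles $$M\to X_M\to\sigma M\to\Sigma M,\qquad \Sigma^{-1}M\to\omega M\to X^M\to M .$$ For $\mu\colon M\to N$ choose morphisms of triangles $(\mu,\xi,s,\Sigma\mu)$ and $(\Sigma^{-1}\mu,t,\xi',\mu)$ between the chosen triangles of $M$ and of $N$; then $\sigma(\underline\mu)=\underline s$ and $\omega(\underline\mu)=\underline t$ define endofunctors $\sigma,\omega$ of $\mathsf T_{\mathbb X}$. The distinguished right-triangles are the diagrams isomorphic in $\mathsf T_{\mathbb X}$ to some $M\xrightarrow{\underline\mu}N\xrightarrow{\underline\nu}P\xrightarrow{\underline\pi}\sigma M$, where $\mu$ is an $\mathbb X$-monomorphism, $M\xrightarrow{\mu}N\xrightarrow{\nu}P\to\Sigma M$ is a distinguished triangle in $\mathsf T$, and $(1_M,n,\pi,1_{\Sigma M})$ is a morphism of triangles from it to $M\to X_M\to\sigma M\to\Sigma M$. Dually, the distinguished left-triangles are the diagrams isomorphic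 in $\mathsf T_{\mathbb X}$ to some $\omega N\xrightarrow{\underline\pi}L\xrightarrow{\underline\lambda}M\xrightarrow{\underline\mu}N$, where $\mu$ is an $\mathbb X$-epimorphism, $\Sigma^{-1}N\to L\xrightarrow{\lambda}M\xrightarrow{\mu}N$ is a distinguished triangle in $\mathsf T$, and $(1_{\Sigma^{-1}N},\pi,n,1_N)$ is a morphism of triangles to it from $\Sigma^{-1}N\to\omega N\to X^N\to N$. This pretriangulated structure is called a triangulated structure if $\mathsf T_{\mathbb X}$ has a structure of triangulated category whose suspension functor is naturally isomorphic to $\sigma$ and whose inverse suspension functor is naturally isomorphic to $\omega$, such that, under these isomorphisms, the distinguished right-triangles are exactly its distinguished triangles $A\to B\to D\to A[1]$, and the distinguished left-triangles are exactly its distinguished triangles written in the form $D[-1]\to A\to B\to D$. Theorem. For every choice of the data above, the pretriangulated structure of $\mathsf T_{\mathbb X}$ is a triangulated structure if and only if $\tau\mathbb X=\mathbb X$, in the sense that the class of objects isomorphic to $\tau X$ for some $X$ in $\mathbb X$ is equal to $\mathbb X$. -/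

import Mathlib

open CategoryTheory CategoryTheory.Limits CategoryTheory.Pretriangulated

universe w v u

noncomputable section

namespace QuotientTriangulation

/-! ### Pretriangulated structures and triangulated structures -/

/-- The data of a pretriangulated structure on a category: an endofunctor `σ` with a class of
distinguished right-triangles `A ⟶ B ⟶ D ⟶ σ A`, and an endofunctor `ω` with a class of
distinguished left-triangles `ω D ⟶ A ⟶ B ⟶ D`. -/
structure PretriangulatedData (C : Type u) [Category.{v} C] where
  /-- the functor `σ` of the right-triangles -/
  σ : C ⥤ C
  /-- the functor `ω` of the left-triangles -/
  ω : C ⥤ C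
  /-- the distinguished right-triangles -/
  right : ∀ {A B D : C}, (A ⟶ B) → (B ⟶ D) → (D ⟶ σ.obj A) → Prop
  /-- the distinguished left-triangles -/
  left : ∀ {A B D : C}, (ω.obj D ⟶ A) → (A ⟶ B) → (B ⟶ D) → Prop

/-- A pretriangulated structure is a triangulated structure if it comes from a structure of
triangulated category (including the octahedral axiom): the suspension is `σ`, its inverse is `ω`,
the distinguished right-triangles `A ⟶ B ⟶ D ⟶ A⟦1⟧` are the distinguished triangles, and the
distinguished left-triangles `D⟦-1⟧ ⟶ A ⟶ B ⟶ D` are the distinguished triangles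
`D⟦-1⟧ ⟶ A ⟶ B ⟶ D⟦-1⟧⟦1⟧` read through the canonical isomorphism `D ≅ D⟦-1⟧⟦1⟧`. -/
def PretriangulatedData.IsTriangulatedStructure {C : Type u} [Category.{v} C] [Preadditive C]
    [HasZeroObject C] (P : PretriangulatedData C) : Prop :=
  ∃ (_ : HasShift C ℤ) (_ : ∀ n : ℤ, (shiftFunctor C n).Additive) (_ : Pretriangulated C)
    (_ : IsTriangulated C) (e : shiftFunctor C (1 : ℤ) ≅ P.σ) (e' : shiftFunctor C (-1 : ℤ) ≅ P.ω),
    (∀ {A B D : C} (f : A ⟶ B) (g : B ⟶ D) (h : D ⟶ P.σ.obj A),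
      P.right f g h ↔ Triangle.mk f g (h ≫ e.inv.app A) ∈ distTriang C) ∧
    (∀ {A B D : C} (f : P.ω.obj D ⟶ A) (g : A ⟶ B) (h : B ⟶ D),
      P.left f g h ↔
        Triangle.mk (e'.hom.app D ≫ f) g (h ≫ (shiftEquiv C (1 : ℤ)).counitIso.inv.app D) ∈
          distTriang C)

/-! ### Serre functors -/

/-- A Serre functor on a `k`-linear category `T`: an autoequivalence `S` together with
`k`-linear isomorphisms `T(A, B) ≅ T(B, S A)^∨`, natural in `A` and `B`. -/
structure SerreFunctor (k : Type w) [Field k] (T : Type u) [Category.{v} T] [Preadditive T]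
    [Linear k T] where
  /-- the underlying functor -/
  functor : T ⥤ T
  isEquivalence : functor.IsEquivalence
  /-- the duality isomorphisms -/
  duality : ∀ A B : T, (A ⟶ B) ≃ₗ[k] Module.Dual k (B ⟶ functor.obj A)
  duality_comp_left : ∀ {A' A B : T} (a : A' ⟶ A) (f : A ⟶ B) (g : B ⟶ functor.obj A'),
    duality A' B (a ≫ f) g = duality A B f (g ≫ functor.map a)
  duality_comp_right : ∀ {A B B' : T} (f : A ⟶ B) (b : B ⟶ B') (g : B' ⟶ functor.obj A),
    duality A B' (f ≫ b) g = duality A B f (b ≫ g)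

/-- The Auslander-Reiten translation `τ = Σ⁻¹ ∘ S` determined by a Serre functor `S`. -/
def SerreFunctor.tau {k : Type w} [Field k] {T : Type u} [Category.{v} T] [Preadditive T]
    [Linear k T] [HasShift T ℤ] (S : SerreFunctor k T) : T ⥤ T :=
  S.functor ⋙ shiftFunctor T (-1 : ℤ)

/-! ### Classes of objects -/

section

variable {T : Type u} [Category.{v} T]

/-- `f : M ⟶ N` is an `𝕏`-monomorphism if each morphism `M ⟶ X` with `X` in `𝕏` factors
through `f`. -/
def IsXMono (𝕏 : ObjectProperty T) {M N : T} (f : M ⟶ N) : Prop :=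
  ∀ ⦃X : T⦄, 𝕏 X → ∀ g : M ⟶ X, ∃ h : N ⟶ X, f ≫ h = g

/-- `f : M ⟶ N` is an `𝕏`-epimorphism if each morphism `X ⟶ N` with `X` in `𝕏` factors
through `f`. -/
def IsXEpi (𝕏 : ObjectProperty T) {M N : T} (f : M ⟶ N) : Prop :=
  ∀ ⦃X : T⦄, 𝕏 X → ∀ g : X ⟶ N, ∃ h : X ⟶ M, h ≫ f = g

/-- `M ⟶ X` is an `𝕏`-preenvelope. -/
def IsPreenvelope (𝕏 : ObjectProperty T) {M X : T} (f : M ⟶ X) : Prop :=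
  𝕏 X ∧ IsXMono 𝕏 f

/-- `X ⟶ M` is an `𝕏`-precover. -/
def IsPrecover (𝕏 : ObjectProperty T) {X M : T} (f : X ⟶ M) : Prop :=
  𝕏 X ∧ IsXEpi 𝕏 f

/-- A class of objects closed under isomorphisms, direct sums and direct summands, which is both
preenveloping and precovering. -/
class IsAdmissible [Preadditive T] [HasBinaryBiproducts T] (𝕏 : ObjectProperty T) : Prop where
  of_iso : ∀ {X Y : T}, (X ≅ Y) → 𝕏 X → 𝕏 Y
  biprod : ∀ {X Y : T}, 𝕏 X → 𝕏 Y → 𝕏 (X ⊞ Y)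
  of_biprod : ∀ {X Y : T}, 𝕏 (X ⊞ Y) → 𝕏 X
  preenveloping : ∀ M : T, ∃ (X : T) (f : M ⟶ X), IsPreenvelope 𝕏 f
  precovering : ∀ M : T, ∃ (X : T) (f : X ⟶ M), IsPrecover 𝕏 f

end

/-! ### The quotient category -/

section

variable {T : Type u} [Category.{v} T]

/-- The morphism `f` factors through an object of `𝕏`. -/
def FactorsThrough (𝕏 : ObjectProperty T) {M N : T} (f : M ⟶ N) : Prop :=
  ∃ (X : T) (_ : 𝕏 X) (a : M ⟶ X) (b : X ⟶ N), a ≫ b = f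

lemma FactorsThrough.comp_left {𝕏 : ObjectProperty T} {L M N : T} {f : M ⟶ N}
    (hf : FactorsThrough 𝕏 f) (a : L ⟶ M) : FactorsThrough 𝕏 (a ≫ f) := by
  obtain ⟨X, hX, c, d, rfl⟩ := hf
  exact ⟨X, hX, a ≫ c, d, by simp⟩

lemma FactorsThrough.comp_right {𝕏 : ObjectProperty T} {M N P : T} {f : M ⟶ N}
    (hf : FactorsThrough 𝕏 f) (b : N ⟶ P) : FactorsThrough 𝕏 (f ≫ b) := by
  obtain ⟨X, hX, c, d, rfl⟩ := hf
  exact ⟨X, hX, c, d ≫ b, by simp⟩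

variable [Preadditive T]

/-- Two parallel morphisms are identified if their difference factors through an object
of `𝕏`. -/
def quotientRel (𝕏 : ObjectProperty T) : HomRel T :=
  fun _ _ f g ↦ FactorsThrough 𝕏 (f - g)

/-- The quotient category `T_𝕏`: same objects as `T`, and morphisms modulo those which factor
through an object of `𝕏`. -/
abbrev QuotientCat (𝕏 : ObjectProperty T) : Type u := CategoryTheory.Quotient (quotientRel 𝕏)

/-- The quotient functor `T ⥤ T_𝕏`. -/
abbrev toQuotient (𝕏 : ObjectProperty T) : T ⥤ QuotientCat 𝕏 :=
  CategoryTheory.Quotient.functor (quotientRel 𝕏)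

variable {𝕏 : ObjectProperty T}

lemma FactorsThrough.neg {M N : T} {f : M ⟶ N} (hf : FactorsThrough 𝕏 f) :
    FactorsThrough 𝕏 (-f) := by
  obtain ⟨X, hX, c, d, rfl⟩ := hf
  exact ⟨X, hX, -c, d, by simp⟩

variable [HasBinaryBiproducts T] [IsAdmissible 𝕏]

lemma FactorsThrough.zero (M N : T) : FactorsThrough 𝕏 (0 : M ⟶ N) := by
  obtain ⟨X, f, hX, -⟩ := IsAdmissible.preenveloping (𝕏 := 𝕏) M
  exact ⟨X, hX, f, 0, by simp⟩

lemma FactorsThrough.add {M N : T} {f g : M ⟶ N} (hf : FactorsThrough 𝕏 f)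
    (hg : FactorsThrough 𝕏 g) : FactorsThrough 𝕏 (f + g) := by
  obtain ⟨X, hX, a, b, rfl⟩ := hf
  obtain ⟨Y, hY, c, d, rfl⟩ := hg
  exact ⟨X ⊞ Y, IsAdmissible.biprod hX hY, biprod.lift a c, biprod.desc b d, by simp⟩

variable (𝕏)

instance quotientRel_congruence : Congruence (quotientRel 𝕏) where
  equivalence :=
    { refl := fun f ↦ by
        have := FactorsThrough.zero (𝕏 := 𝕏)
        simpa [quotientRel] using this _ _
      symm := fun {f g} h ↦ by
        have := FactorsThrough.neg h
        simpa [quotientRel] using this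
      trans := fun {f g h} h₁ h₂ ↦ by
        have := FactorsThrough.add h₁ h₂
        simpa [quotientRel] using this }
  comp_left f _ _ h := by
    have := FactorsThrough.comp_left h f
    simpa [quotientRel] using this
  comp_right f h := by
    have := FactorsThrough.comp_right h f
    simpa [quotientRel] using this

lemma quotientRel_add ⦃X Y : T⦄ (f₁ f₂ g₁ g₂ : X ⟶ Y) (h₁ : quotientRel 𝕏 f₁ f₂)
    (h₂ : quotientRel 𝕏 g₁ g₂) : quotientRel 𝕏 (f₁ + g₁) (f₂ + g₂) := by
  have := FactorsThrough.add h₁ h₂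
  have e : f₁ + g₁ - (f₂ + g₂) = f₁ - f₂ + (g₁ - g₂) := by abel
  rwa [quotientRel, e]

instance quotientPreadditive : Preadditive (QuotientCat 𝕏) :=
  CategoryTheory.Quotient.preadditive _ (quotientRel_add 𝕏)

instance toQuotient_additive : (toQuotient 𝕏).Additive :=
  CategoryTheory.Quotient.functor_additive _ (quotientRel_add 𝕏)

instance quotientHasZeroObject [HasZeroObject T] : HasZeroObject (QuotientCat 𝕏) :=
  ((toQuotient 𝕏).map_isZero (isZero_zero T)).hasZeroObject

end

/-! ### The pretriangulated structure of the quotient category -/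

section

variable {T : Type u} [Category.{v} T] [Preadditive T] [HasZeroObject T] [HasShift T ℤ]
  [∀ n : ℤ, (shiftFunctor T n).Additive] [Pretriangulated T]

/-- A choice, for each object `M` of `T`, of an `𝕏`-preenvelope `M ⟶ X_M` completed to a
distinguished triangle `M ⟶ X_M ⟶ σ M ⟶ Σ M`, and of an `𝕏`-precover `X^M ⟶ M` completed to a
distinguished triangle `ω M ⟶ X^M ⟶ M ⟶ Σ (ω M)` (which is the triangle
`Σ⁻¹ M ⟶ ω M ⟶ X^M ⟶ M`, rotated). -/
structure ApproximationTriangles (𝕏 : ObjectProperty T) where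
  /-- the object `X_M` -/
  env : T → T
  /-- the object `σ M` -/
  sigma : T → T
  /-- the preenvelope `M ⟶ X_M` -/
  envι : ∀ M, M ⟶ env M
  /-- the morphism `X_M ⟶ σ M` -/
  envπ : ∀ M, env M ⟶ sigma M
  /-- the morphism `σ M ⟶ Σ M` -/
  envδ : ∀ M, sigma M ⟶ M⟦(1 : ℤ)⟧
  isPreenvelope : ∀ M, IsPreenvelope 𝕏 (envι M)
  env_dist : ∀ M, Triangle.mk (envι M) (envπ M) (envδ M) ∈ distTriang T
  /-- the object `X^M` -/
  cov : T → T
  /-- the object `ω M` -/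
  omega : T → T
  /-- the morphism `ω M ⟶ X^M` -/
  covι : ∀ M, omega M ⟶ cov M
  /-- the precover `X^M ⟶ M` -/
  covπ : ∀ M, cov M ⟶ M
  /-- the morphism `M ⟶ Σ (ω M)` -/
  covδ : ∀ M, M ⟶ (omega M)⟦(1 : ℤ)⟧
  isPrecover : ∀ M, IsPrecover 𝕏 (covπ M)
  cov_dist : ∀ M, Triangle.mk (covι M) (covπ M) (covδ M) ∈ distTriang T

namespace ApproximationTriangles

variable {𝕏 : ObjectProperty T} (c : ApproximationTriangles 𝕏)

/-- `s : σ M ⟶ σ N` is part of a morphism of triangles `(μ, ξ, s)`. -/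
def SigmaLift {M N : T} (μ : M ⟶ N) (s : c.sigma M ⟶ c.sigma N) : Prop :=
  ∃ ξ : c.env M ⟶ c.env N, c.envι M ≫ ξ = μ ≫ c.envι N ∧ c.envπ M ≫ s = ξ ≫ c.envπ N ∧
    c.envδ M ≫ μ⟦(1 : ℤ)⟧' = s ≫ c.envδ N

/-- `t : ω M ⟶ ω N` is part of a morphism of triangles `(t, ξ, μ)`. -/
def OmegaLift {M N : T} (μ : M ⟶ N) (t : c.omega M ⟶ c.omega N) : Prop :=
  ∃ ξ : c.cov M ⟶ c.cov N, c.covι M ≫ ξ = t ≫ c.covι N ∧ c.covπ M ≫ μ = ξ ≫ c.covπ N ∧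
    c.covδ M ≫ t⟦(1 : ℤ)⟧' = μ ≫ c.covδ N

lemma exists_sigmaLift {M N : T} (μ : M ⟶ N) : ∃ s, c.SigmaLift μ s := by
  obtain ⟨ξ, hξ⟩ := (c.isPreenvelope M).2 (c.isPreenvelope N).1 (μ ≫ c.envι N)
  obtain ⟨s, h₁, h₂⟩ := complete_distinguished_triangle_morphism _ _ (c.env_dist M) (c.env_dist N)
    μ ξ hξ
  exact ⟨s, ξ, hξ, h₁, h₂⟩

lemma exists_omegaLift {M N : T} (μ : M ⟶ N) : ∃ t, c.OmegaLift μ t := by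
  obtain ⟨ξ, hξ⟩ := (c.isPrecover N).2 (c.isPrecover M).1 (c.covπ M ≫ μ)
  obtain ⟨t, h₁, h₂⟩ := complete_distinguished_triangle_morphism₁ _ _ (c.cov_dist M)
    (c.cov_dist N) ξ μ hξ.symm
  exact ⟨t, ξ, h₁, hξ.symm, h₂⟩

lemma sigmaLift_unique {M N : T} {μ μ' : M ⟶ N} {s s' : c.sigma M ⟶ c.sigma N}
    (hs : c.SigmaLift μ s) (hs' : c.SigmaLift μ' s') (h : quotientRel 𝕏 μ μ') :
    quotientRel 𝕏 s s' := by
  obtain ⟨_, -, -, h₁⟩ := hs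
  obtain ⟨_, -, -, h₂⟩ := hs'
  obtain ⟨Y, hY, a, b, hab⟩ := h
  obtain ⟨a', ha'⟩ := (c.isPreenvelope M).2 hY a
  have h₀ : c.envδ M ≫ (c.envι M)⟦(1 : ℤ)⟧' = 0 :=
    comp_distTriang_mor_zero₃₁ _ (c.env_dist M)
  have h₃ : (s - s') ≫ c.envδ N = 0 := by
    rw [Preadditive.sub_comp, ← h₁, ← h₂, ← Preadditive.comp_sub, ← Functor.map_sub, ← hab, ← ha',
      Functor.map_comp, Functor.map_comp, Category.assoc, reassoc_of% h₀, zero_comp]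
  obtain ⟨d, hd⟩ := Triangle.coyoneda_exact₃ _ (c.env_dist N) (s - s') h₃
  exact ⟨_, (c.isPreenvelope N).1, d, c.envπ N, hd.symm⟩

lemma omegaLift_unique {M N : T} {μ μ' : M ⟶ N} {t t' : c.omega M ⟶ c.omega N}
    (ht : c.OmegaLift μ t) (ht' : c.OmegaLift μ' t') (h : quotientRel 𝕏 μ μ') :
    quotientRel 𝕏 t t' := by
  obtain ⟨_, -, -, h₁⟩ := ht
  obtain ⟨_, -, -, h₂⟩ := ht'
  obtain ⟨Y, hY, a, b, hab⟩ := h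
  obtain ⟨b', hb'⟩ := (c.isPrecover N).2 hY b
  have h₀ : c.covπ N ≫ c.covδ N = 0 := comp_distTriang_mor_zero₂₃ _ (c.cov_dist N)
  have h₃ : c.covδ M ≫ (t - t')⟦(1 : ℤ)⟧' = 0 := by
    rw [Functor.map_sub, Preadditive.comp_sub, h₁, h₂, ← Preadditive.sub_comp, ← hab, ← hb',
      Category.assoc, Category.assoc, h₀, comp_zero, comp_zero]
  obtain ⟨d, hd⟩ : ∃ d : (c.cov M)⟦(1 : ℤ)⟧ ⟶ (c.omega N)⟦(1 : ℤ)⟧,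
      (t - t')⟦(1 : ℤ)⟧' = (-(c.covι M)⟦(1 : ℤ)⟧') ≫ d :=
    Triangle.yoneda_exact₃ _ (rot_of_distTriang _ (c.cov_dist M)) ((t - t')⟦(1 : ℤ)⟧') h₃
  obtain ⟨d', rfl⟩ := (shiftFunctor T (1 : ℤ)).map_surjective d
  refine ⟨_, (c.isPrecover M).1, c.covι M, -d', (shiftFunctor T (1 : ℤ)).map_injective ?_⟩
  rw [hd, Functor.map_comp, Functor.map_neg, Preadditive.comp_neg, Preadditive.neg_comp]

lemma sigmaLift_id (M : T) : c.SigmaLift (𝟙 M) (𝟙 _) := ⟨𝟙 _, by simp, by simp, by simp⟩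

lemma omegaLift_id (M : T) : c.OmegaLift (𝟙 M) (𝟙 _) := ⟨𝟙 _, by simp, by simp, by simp⟩

lemma SigmaLift.comp {c : ApproximationTriangles 𝕏} {L M N : T} {μ : L ⟶ M} {μ' : M ⟶ N}
    {s : c.sigma L ⟶ c.sigma M} {s' : c.sigma M ⟶ c.sigma N} (h : c.SigmaLift μ s)
    (h' : c.SigmaLift μ' s') : c.SigmaLift (μ ≫ μ') (s ≫ s') := by
  obtain ⟨ξ, h₁, h₂, h₃⟩ := h
  obtain ⟨ξ', h₁', h₂', h₃'⟩ := h'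
  refine ⟨ξ ≫ ξ', ?_, ?_, ?_⟩
  · rw [reassoc_of% h₁, h₁', Category.assoc]
  · rw [reassoc_of% h₂, h₂', Category.assoc]
  · rw [Functor.map_comp, reassoc_of% h₃, h₃', Category.assoc]

lemma OmegaLift.comp {c : ApproximationTriangles 𝕏} {L M N : T} {μ : L ⟶ M} {μ' : M ⟶ N}
    {t : c.omega L ⟶ c.omega M} {t' : c.omega M ⟶ c.omega N} (h : c.OmegaLift μ t)
    (h' : c.OmegaLift μ' t') : c.OmegaLift (μ ≫ μ') (t ≫ t') := by
  obtain ⟨ξ, h₁, h₂, h₃⟩ := h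
  obtain ⟨ξ', h₁', h₂', h₃'⟩ := h'
  refine ⟨ξ ≫ ξ', ?_, ?_, ?_⟩
  · rw [reassoc_of% h₁, h₁', Category.assoc]
  · rw [reassoc_of% h₂, h₂', Category.assoc]
  · rw [Functor.map_comp, reassoc_of% h₃, h₃', Category.assoc]

variable [IsAdmissible 𝕏]

/-- The assignment `μ ↦ class of s`, as a functor on `T`. -/
@[simps]
def sigmaPre : T ⥤ QuotientCat 𝕏 where
  obj M := (toQuotient 𝕏).obj (c.sigma M)
  map μ := (toQuotient 𝕏).map (c.exists_sigmaLift μ).choose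
  map_id M := by
    rw [← (toQuotient 𝕏).map_id]
    exact CategoryTheory.Quotient.sound _ (c.sigmaLift_unique (c.exists_sigmaLift _).choose_spec
      (c.sigmaLift_id M) ((quotientRel_congruence 𝕏).equivalence.refl _))
  map_comp μ μ' := by
    rw [← (toQuotient 𝕏).map_comp]
    exact CategoryTheory.Quotient.sound _ (c.sigmaLift_unique (c.exists_sigmaLift _).choose_spec
      ((c.exists_sigmaLift μ).choose_spec.comp (c.exists_sigmaLift μ').choose_spec)
      ((quotientRel_congruence 𝕏).equivalence.refl _))

/-- The assignment `μ ↦ class of t`, as a functor on `T`. -/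
@[simps]
def omegaPre : T ⥤ QuotientCat 𝕏 where
  obj M := (toQuotient 𝕏).obj (c.omega M)
  map μ := (toQuotient 𝕏).map (c.exists_omegaLift μ).choose
  map_id M := by
    rw [← (toQuotient 𝕏).map_id]
    exact CategoryTheory.Quotient.sound _ (c.omegaLift_unique (c.exists_omegaLift _).choose_spec
      (c.omegaLift_id M) ((quotientRel_congruence 𝕏).equivalence.refl _))
  map_comp μ μ' := by
    rw [← (toQuotient 𝕏).map_comp]
    exact CategoryTheory.Quotient.sound _ (c.omegaLift_unique (c.exists_omegaLift _).choose_spec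
      ((c.exists_omegaLift μ).choose_spec.comp (c.exists_omegaLift μ').choose_spec)
      ((quotientRel_congruence 𝕏).equivalence.refl _))

/-- The endofunctor `σ` of `T_𝕏`. -/
def sigmaFunctor : QuotientCat 𝕏 ⥤ QuotientCat 𝕏 :=
  CategoryTheory.Quotient.lift _ c.sigmaPre fun _ _ _ _ h ↦ CategoryTheory.Quotient.sound _
    (c.sigmaLift_unique (c.exists_sigmaLift _).choose_spec (c.exists_sigmaLift _).choose_spec h)

/-- The endofunctor `ω` of `T_𝕏`. -/
def omegaFunctor : QuotientCat 𝕏 ⥤ QuotientCat 𝕏 :=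
  CategoryTheory.Quotient.lift _ c.omegaPre fun _ _ _ _ h ↦ CategoryTheory.Quotient.sound _
    (c.omegaLift_unique (c.exists_omegaLift _).choose_spec (c.exists_omegaLift _).choose_spec h)

/-- The defining property of `σ` on morphisms. -/
lemma sigmaFunctor_map {M N : T} {μ : M ⟶ N} {s : c.sigma M ⟶ c.sigma N}
    (h : c.SigmaLift μ s) :
    c.sigmaFunctor.map ((toQuotient 𝕏).map μ) = (toQuotient 𝕏).map s :=
  CategoryTheory.Quotient.sound _ (c.sigmaLift_unique (c.exists_sigmaLift μ).choose_spec h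
    ((quotientRel_congruence 𝕏).equivalence.refl _))

/-- The defining property of `ω` on morphisms. -/
lemma omegaFunctor_map {M N : T} {μ : M ⟶ N} {t : c.omega M ⟶ c.omega N}
    (h : c.OmegaLift μ t) :
    c.omegaFunctor.map ((toQuotient 𝕏).map μ) = (toQuotient 𝕏).map t :=
  CategoryTheory.Quotient.sound _ (c.omegaLift_unique (c.exists_omegaLift μ).choose_spec h
    ((quotientRel_congruence 𝕏).equivalence.refl _))

/-- The class of a morphism `P ⟶ σ M` of `T`, as a morphism of `T_𝕏` to `σ M`. -/
def toSigma {P M : T} (π : P ⟶ c.sigma M) :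
    (toQuotient 𝕏).obj P ⟶ c.sigmaFunctor.obj ((toQuotient 𝕏).obj M) :=
  (toQuotient 𝕏).map π

/-- The class of a morphism `ω N ⟶ L` of `T`, as a morphism of `T_𝕏` from `ω N`. -/
def fromOmega {N L : T} (π : c.omega N ⟶ L) :
    c.omegaFunctor.obj ((toQuotient 𝕏).obj N) ⟶ (toQuotient 𝕏).obj L :=
  (toQuotient 𝕏).map π

/-- The distinguished right-triangles of `T_𝕏`: up to isomorphism they are the
`M ⟶ N ⟶ P ⟶ σ M` given by the classes of `μ`, `ν`, `π`, where `μ` is an `𝕏`-monomorphism,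
`(μ, ν, δ)` is a distinguished triangle in `T`, and `(𝟙 M, n, π)` is a morphism of triangles
from it to `M ⟶ X_M ⟶ σ M ⟶ Σ M`. -/
def RightDistinguished {A B D : QuotientCat 𝕏} (f : A ⟶ B) (g : B ⟶ D)
    (h : D ⟶ c.sigmaFunctor.obj A) : Prop :=
  ∃ (M N P : T) (μ : M ⟶ N) (ν : N ⟶ P) (δ : P ⟶ M⟦(1 : ℤ)⟧) (n : N ⟶ c.env M)
    (π : P ⟶ c.sigma M),
    IsXMono 𝕏 μ ∧ Triangle.mk μ ν δ ∈ distTriang T ∧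
    μ ≫ n = c.envι M ∧ ν ≫ π = n ≫ c.envπ M ∧ π ≫ c.envδ M = δ ∧
    ∃ (a : A ≅ (toQuotient 𝕏).obj M) (b : B ≅ (toQuotient 𝕏).obj N)
      (d : D ≅ (toQuotient 𝕏).obj P),
      f ≫ b.hom = a.hom ≫ (toQuotient 𝕏).map μ ∧
      g ≫ d.hom = b.hom ≫ (toQuotient 𝕏).map ν ∧
      h ≫ c.sigmaFunctor.map a.hom = d.hom ≫ c.toSigma π

/-- The distinguished left-triangles of `T_𝕏`: up to isomorphism they are the
`ω N ⟶ L ⟶ M ⟶ N` given by the classes of `π`, `l`, `μ`, where `μ` is an `𝕏`-epimorphism,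
`(l, μ, δ)` is a distinguished triangle in `T`, and `(π, n, 𝟙 N)` is a morphism of triangles
to it from `ω N ⟶ X^N ⟶ N ⟶ Σ (ω N)`. -/
def LeftDistinguished {A B D : QuotientCat 𝕏} (f : c.omegaFunctor.obj D ⟶ A) (g : A ⟶ B)
    (h : B ⟶ D) : Prop :=
  ∃ (L M N : T) (l : L ⟶ M) (μ : M ⟶ N) (δ : N ⟶ L⟦(1 : ℤ)⟧) (n : c.cov N ⟶ M)
    (π : c.omega N ⟶ L),
    IsXEpi 𝕏 μ ∧ Triangle.mk l μ δ ∈ distTriang T ∧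
    n ≫ μ = c.covπ N ∧ π ≫ l = c.covι N ≫ n ∧ c.covδ N ≫ π⟦(1 : ℤ)⟧' = δ ∧
    ∃ (a : A ≅ (toQuotient 𝕏).obj L) (b : B ≅ (toQuotient 𝕏).obj M)
      (d : D ≅ (toQuotient 𝕏).obj N),
      f ≫ a.hom = c.omegaFunctor.map d.hom ≫ c.fromOmega π ∧
      g ≫ b.hom = a.hom ≫ (toQuotient 𝕏).map l ∧
      h ≫ d.hom = b.hom ≫ (toQuotient 𝕏).map μ

/-- The pretriangulated structure of the quotient category `T_𝕏`. -/
def pretriangulatedData : PretriangulatedData (QuotientCat 𝕏) where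
  σ := c.sigmaFunctor
  ω := c.omegaFunctor
  right f g h := c.RightDistinguished f g h
  left f g h := c.LeftDistinguished f g h

end ApproximationTriangles

end

end QuotientTriangulation

end

/-!
Let `(μ, ν, δ)` be a distinguished triangle `M ⟶ N ⟶ P ⟶ Σ M` of `T`. The morphism `μ` is an
`𝕏`-monomorphism if and only if `δ` is killed by the suspensions of all morphisms from `M` to `𝕏`,
and `ν` is an `𝕏`-epimorphism if and only if `δ` is killed by all morphisms from `𝕏` to `P`. By
Serre duality, `δ` is killed by all morphisms from `Y` if and only if it is killed by the
suspensions of all morphisms to `τ Y` (`SerreFunctor.forall_comp_eq_zero_iff`). Hence, if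
`τ 𝕏 = 𝕏`, then `𝕏`-monomorphisms and `𝕏`-epimorphisms correspond to each other
(`isXMono_iff_isXEpi`).

Under this correspondence the quotient is triangulated, for the same reasons as the stable category
of a Frobenius category (`ApproximationTriangles.isTriangulatedStructure`). Without the
correspondence, the right-triangles already satisfy all the axioms except that rotation is only
available in one direction and that `σ` need not be an equivalence
(`ApproximationTriangles.isRightTriangulation`, `ApproximationTriangles.isTriangulated_quotient`).
The correspondence shows that a preenvelope `M ⟶ X_M` and its cone `X_M ⟶ σ M` form a precover of
`σ M` and conversely, so that `σ` is an equivalence with quasi-inverse `ω`; then the converse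
rotation is automatic (`IsRightTriangulation.of_rotate`), and the left-triangles are rotations of
the right-triangles (`ApproximationTriangles.leftDistinguished_iff`). A shift by `ℤ` whose value at
`1` is `σ` is obtained by replacing the quotient by the equivalent category of spectra of `σ`, on
which the shift is a reindexing (`exists_hasShift_of_isEquivalence`).

Conversely, suppose that the quotient is triangulated. An `𝕏`-monomorphism whose cone is in `𝕏`
becomes invertible in the quotient; applied to the fibre of `X^{σ M} ⟶ σ M ⟶ Σ M`, this shows that
all compositions `X ⟶ σ M ⟶ Σ M` with `X` in `𝕏` vanish (`ApproximationTriangles.comp_envδ`).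
For `M = τ X`, Serre duality gives that `σ M ⟶ Σ M` itself vanishes, hence `τ X` is a direct summand
of its preenvelope and belongs to `𝕏`. Since `σ` is essentially surjective, the same vanishing shows
that a morphism `N ⟶ Σ X` which is killed by all morphisms from `𝕏` is zero
(`ApproximationTriangles.eq_zero_of_forall_comp_eq_zero`). If `S Z ≅ Σ Y` with `Y` in `𝕏`, then by
Serre duality the third morphism `Z ⟶ Σ ω Z` of the precover triangle of `Z` vanishes, so that `Z`
is in `𝕏` and `Y ≅ τ Z`.
-/

namespace QuotientTriangulation

/-! ### The shift generated by an autoequivalence -/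

/-- A spectrum of an endofunctor `E`: a family of objects indexed by `ℤ` with isomorphisms from
`E` of each term to the next one. The indices `n` and `m = n + 1` are kept as separate variables,
so that reindexing a spectrum does not involve transport along equalities. -/
structure Spectrum {C : Type u} [Category.{v} C] (E : C ⥤ C) where
  /-- the terms of the spectrum -/
  obj : ℤ → C
  /-- the isomorphisms between consecutive terms -/
  iso : ∀ n m : ℤ, n + 1 = m → (E.obj (obj n) ≅ obj m)

namespace Spectrum

variable {C : Type u} [Category.{v} C] {E : C ⥤ C}

/-- A morphism of spectra: a family of morphisms compatible with the structure isomorphisms. -/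
@[ext]
structure Hom (X Y : Spectrum E) where
  /-- the components of the morphism -/
  app : ∀ n, X.obj n ⟶ Y.obj n
  comm : ∀ n m h, E.map (app n) ≫ (Y.iso n m h).hom = (X.iso n m h).hom ≫ app m

instance : Category (Spectrum E) where
  Hom := Hom
  id X := ⟨fun _ ↦ 𝟙 _, by simp⟩
  comp f g := ⟨fun n ↦ f.app n ≫ g.app n, fun n m h ↦ by
    rw [E.map_comp, Category.assoc, g.comm, ← Category.assoc, f.comm, Category.assoc]⟩

@[ext]
lemma hom_ext {X Y : Spectrum E} {f g : X ⟶ Y} (h : ∀ n, f.app n = g.app n) : f = g :=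
  Hom.ext (funext h)

@[simp] lemma id_app (X : Spectrum E) (n : ℤ) : Hom.app (𝟙 X) n = 𝟙 _ := rfl

@[simp] lemma comp_app {X Y Z : Spectrum E} (f : X ⟶ Y) (g : Y ⟶ Z) (n : ℤ) :
    (f ≫ g).app n = f.app n ≫ g.app n := rfl

lemma map_eqToHom_iso (X : Spectrum E) {n n' m m' : ℤ} (hn : n = n') (hm : m = m')
    (h : n' + 1 = m') (e₁ : X.obj n = X.obj n') (e₂ : X.obj m = X.obj m') :
    E.map (eqToHom e₁) ≫ (X.iso n' m' h).hom =
      (X.iso n m (by rw [hn, hm, h])).hom ≫ eqToHom e₂ := by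
  subst hn hm; simp

lemma app_eqToHom {X Y : Spectrum E} (f : X ⟶ Y) {n n' : ℤ} (hn : n = n')
    (e₁ : Y.obj n = Y.obj n') (e₂ : X.obj n = X.obj n') :
    f.app n ≫ eqToHom e₁ = eqToHom e₂ ≫ f.app n' := by
  subst hn; simp

lemma eqToHom_app {X Y : Spectrum E} (h : X = Y) (n : ℤ) :
    Hom.app (eqToHom h) n = eqToHom (by rw [h]) := by
  subst h; rfl

/-- Reindexing of spectra, `(X⟦a⟧)ₙ = X_{n + a}`. -/
@[simps]
def reindex (a : ℤ) : Spectrum E ⥤ Spectrum E where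
  obj X := ⟨fun n ↦ X.obj (n + a), fun n m h ↦ X.iso (n + a) (m + a) (by lia)⟩
  map f := ⟨fun n ↦ f.app (n + a), fun _ _ _ ↦ f.comm _ _ _⟩

/-- Two reindexings of a spectrum along equal translations of `ℤ` are isomorphic. -/
def reindexIso (X : Spectrum E) (φ ψ : ℤ → ℤ) (hφ : ∀ n m, n + 1 = m → φ n + 1 = φ m)
    (h : ∀ n, φ n = ψ n) :
    (⟨fun n ↦ X.obj (φ n), fun n m h ↦ X.iso _ _ (hφ n m h)⟩ : Spectrum E) ≅
      ⟨fun n ↦ X.obj (ψ n), fun n m h' ↦ X.iso _ _ (by rw [← h, ← h, hφ n m h'])⟩ where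
  hom := ⟨fun n ↦ eqToHom (congrArg X.obj (h n)),
    fun n m h' ↦ X.map_eqToHom_iso (h n) (h m) _ _ _⟩
  inv := ⟨fun n ↦ eqToHom (congrArg X.obj (h n).symm),
    fun n m h' ↦ X.map_eqToHom_iso (h n).symm (h m).symm _ _ _⟩

variable (E) in
/-- Reindexings, as the data of a shift. -/
def shiftMkCore : ShiftMkCore (Spectrum E) ℤ where
  F := reindex
  zero := NatIso.ofComponents
    (fun X ↦ X.reindexIso (fun n ↦ n + 0) (fun n ↦ n) (by lia) (by lia))
    (fun f ↦ hom_ext fun n ↦ app_eqToHom f (by lia)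
      (congrArg _ (by lia)) (congrArg _ (by lia)))
  add a b := NatIso.ofComponents
    (fun X ↦ X.reindexIso (fun n ↦ n + (a + b)) (fun n ↦ n + b + a) (by lia) (by lia))
    (fun f ↦ hom_ext fun n ↦ app_eqToHom f (by lia)
      (congrArg _ (by lia)) (congrArg _ (by lia)))
  assoc_hom_app a b c X := by
    ext n
    rw [comp_app, comp_app, comp_app, eqToHom_app]
    change eqToHom (congrArg X.obj (show n + (a + b + c) = n + c + (a + b) from by lia)) ≫
        eqToHom (congrArg X.obj (show n + c + (a + b) = n + c + b + a from by lia)) =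
      eqToHom _ ≫ eqToHom (congrArg X.obj (show n + (a + (b + c)) = n + (b + c) + a from by lia)) ≫
        eqToHom (congrArg X.obj (show n + (b + c) + a = n + c + b + a from by lia))
    simp only [eqToHom_trans]
    exact (eqToHom_trans _ _).symm
  zero_add_hom_app a X := by
    ext n
    rw [comp_app, eqToHom_app]
    change eqToHom (congrArg X.obj (show n + (0 + a) = n + a + 0 from by lia)) =
      eqToHom _ ≫ eqToHom (congrArg X.obj (show n + a = n + a + 0 from by lia))
    exact (eqToHom_trans _ _).symm
  add_zero_hom_app a X := by
    ext n
    rw [comp_app, eqToHom_app]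
    change eqToHom (congrArg X.obj (show n + (a + 0) = n + 0 + a from by lia)) =
      eqToHom _ ≫ eqToHom (congrArg X.obj (show n + a = n + 0 + a from by lia))
    exact (eqToHom_trans _ _).symm

instance : HasShift (Spectrum E) ℤ := hasShiftMk _ _ (shiftMkCore E)

variable (E) in
/-- Evaluation of spectra at `0`. -/
@[simps]
def eval : Spectrum E ⥤ C where
  obj X := X.obj 0
  map f := f.app 0

/-- The first term of a spectrum is the value of `E` on its term of index `0`. -/
def shiftEvalIso : shiftFunctor (Spectrum E) (1 : ℤ) ⋙ eval E ≅ eval E ⋙ E :=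
  show reindex 1 ⋙ eval E ≅ eval E ⋙ E from
  NatIso.ofComponents (fun X ↦ (X.iso 0 (0 + 1) rfl).symm) (fun {X Y} f ↦ by
    change f.app (0 + 1) ≫ (Y.iso 0 (0 + 1) rfl).inv =
      (X.iso 0 (0 + 1) rfl).inv ≫ E.map (f.app 0)
    rw [Iso.comp_inv_eq, Category.assoc, f.comm, Iso.inv_hom_id_assoc])

end Spectrum

/-- Given bijections from each term of a family to the next one, every element of the term of
index `0` extends to a compatible family of elements. -/
lemma exists_family_of_equiv {H : ℤ → Type*} (e : ∀ n, H n ≃ H (n + 1)) (x : H 0) :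
    ∃ f : ∀ n, H n, f 0 = x ∧ ∀ n, e n (f n) = f (n + 1) := by
  let f : ∀ n, H n := fun n ↦ match n with
    | Int.ofNat n => Nat.rec (motive := fun n ↦ H (Int.ofNat n)) x (fun n y ↦ e (Int.ofNat n) y) n
    | Int.negSucc n => Nat.rec (motive := fun n ↦ H (Int.negSucc n)) ((e (-1)).symm x)
        (fun n y ↦ (e (Int.negSucc (n + 1))).symm y) n
  refine ⟨f, rfl, fun n ↦ ?_⟩
  match n with
  | Int.ofNat n => rfl
  | Int.negSucc 0 => exact (e (Int.negSucc 0)).apply_symm_apply _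
  | Int.negSucc (n + 1) => exact (e (Int.negSucc (n + 1))).apply_symm_apply _

namespace Spectrum

variable {C : Type u} [Category.{v} C] {E : C ⥤ C} [E.IsEquivalence]

/-- Transport of morphisms between terms of index `n` to terms of index `n + 1`. -/
noncomputable def homEquiv (X Y : Spectrum E) (n : ℤ) :
    (X.obj n ⟶ Y.obj n) ≃ (X.obj (n + 1) ⟶ Y.obj (n + 1)) :=
  (Functor.FullyFaithful.ofFullyFaithful E).homEquiv.trans
    (Iso.homCongr (X.iso n (n + 1) rfl) (Y.iso n (n + 1) rfl))

lemma homEquiv_apply_eq_iff {X Y : Spectrum E} {n : ℤ} (f : X.obj n ⟶ Y.obj n)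
    (g : X.obj (n + 1) ⟶ Y.obj (n + 1)) :
    homEquiv X Y n f = g ↔
      E.map f ≫ (Y.iso n (n + 1) rfl).hom = (X.iso n (n + 1) rfl).hom ≫ g := by
  rw [← Iso.inv_comp_eq]
  simp [homEquiv]

lemma homEquiv_app {X Y : Spectrum E} (f : X ⟶ Y) (n : ℤ) :
    homEquiv X Y n (f.app n) = f.app (n + 1) :=
  (homEquiv_apply_eq_iff _ _).2 (f.comm _ _ _)

instance : (eval E).Faithful where
  map_injective {X Y f g} h := by
    ext n
    induction n using Int.induction_on with
    | zero => exact h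
    | succ n ih => rw [← homEquiv_app, ih, homEquiv_app]
    | pred n ih =>
      apply (homEquiv X Y _).injective
      rw [homEquiv_app, homEquiv_app]
      rwa [sub_add_cancel]

/-- Evaluation is full: a morphism between the terms of index `0` extends uniquely in both
directions. -/
instance : (eval E).Full where
  map_surjective {X Y} f := by
    obtain ⟨g, hg, hg'⟩ := exists_family_of_equiv (homEquiv X Y) f
    exact ⟨⟨g, fun n m h ↦ by
      subst h; exact (homEquiv_apply_eq_iff _ _).1 (hg' n)⟩, hg⟩

instance : (eval E).EssSurj where
  mem_essImage X := by
    -- the spectrum of iterated values of `E` and of a quasi-inverse on `X`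
    let e := E.asEquivalence
    let obj : ℤ → C := fun n ↦ match n with
      | Int.ofNat n => Nat.rec X (fun _ Y ↦ E.obj Y) n
      | Int.negSucc n => Nat.rec (e.inverse.obj X) (fun _ Y ↦ e.inverse.obj Y) n
    let iso : ∀ n, E.obj (obj n) ≅ obj (n + 1) := fun n ↦ match n with
      | Int.ofNat n => Iso.refl _
      | Int.negSucc 0 => e.counitIso.app X
      | Int.negSucc (n + 1) => e.counitIso.app (obj (Int.negSucc n))
    exact ⟨⟨obj, fun n m h ↦ iso n ≪≫ eqToIso (by rw [h])⟩, ⟨Iso.refl _⟩⟩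

instance : (eval E).IsEquivalence where

end Spectrum

/-- Every autoequivalence is the functor `⟦1⟧` of a shift by `ℤ`. -/
lemma exists_hasShift_of_isEquivalence {C : Type u} [Category.{v} C] (E : C ⥤ C)
    [E.IsEquivalence] :
    ∃ _ : HasShift C ℤ, Nonempty (shiftFunctor C (1 : ℤ) ≅ E) := by
  let s : ℤ → C ⥤ C := fun a ↦
    (Spectrum.eval E).inv ⋙ shiftFunctor (Spectrum E) a ⋙ Spectrum.eval E
  let i : ∀ a, Spectrum.eval E ⋙ s a ≅ shiftFunctor (Spectrum E) a ⋙ Spectrum.eval E := fun a ↦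
    (Functor.associator _ _ _).symm ≪≫
      Functor.isoWhiskerRight (Spectrum.eval E).asEquivalence.unitIso.symm _ ≪≫
      Functor.leftUnitor _
  refine ⟨HasShift.induced (Spectrum.eval E) ℤ s i, ⟨?_⟩⟩
  change s 1 ≅ E
  exact Functor.isoWhiskerLeft _ Spectrum.shiftEvalIso ≪≫ (Functor.associator _ _ _).symm ≪≫
    Functor.isoWhiskerRight (Spectrum.eval E).asEquivalence.counitIso _ ≪≫ Functor.leftUnitor _

/-! ### Pretriangulated categories from one-sided rotation -/

section

variable {C : Type u} [Category.{v} C] [Preadditive C] [HasZeroObject C] [HasShift C ℤ]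

/-- The axioms of the distinguished triangles of a pretriangulated category, where the rotation
axiom is only required in one direction. -/
structure IsRightTriangulation
    (D : ∀ ⦃X Y Z : C⦄, (X ⟶ Y) → (Y ⟶ Z) → (Z ⟶ X⟦(1 : ℤ)⟧) → Prop) : Prop where
  of_iso : ∀ ⦃X Y Z X' Y' Z' : C⦄ (f : X ⟶ Y) (g : Y ⟶ Z) (h : Z ⟶ X⟦(1 : ℤ)⟧) (f' : X' ⟶ Y')
    (g' : Y' ⟶ Z') (h' : Z' ⟶ X'⟦(1 : ℤ)⟧) (a : X ≅ X') (b : Y ≅ Y') (c : Z ≅ Z'),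
    f ≫ b.hom = a.hom ≫ f' → g ≫ c.hom = b.hom ≫ g' → h ≫ a.hom⟦(1 : ℤ)⟧' = c.hom ≫ h' →
    D f' g' h' → D f g h
  contractible : ∀ X Z : C, IsZero Z → D (𝟙 X) (0 : X ⟶ Z) 0
  exists_cocone : ∀ ⦃X Y : C⦄ (f : X ⟶ Y),
    ∃ (Z : C) (g : Y ⟶ Z) (h : Z ⟶ X⟦(1 : ℤ)⟧), D f g h
  rotate : ∀ ⦃X Y Z : C⦄ (f : X ⟶ Y) (g : Y ⟶ Z) (h : Z ⟶ X⟦(1 : ℤ)⟧), D f g h →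
    D g h (-f⟦(1 : ℤ)⟧')
  exists_hom : ∀ ⦃X Y Z X' Y' Z' : C⦄ (f : X ⟶ Y) (g : Y ⟶ Z) (h : Z ⟶ X⟦(1 : ℤ)⟧)
    (f' : X' ⟶ Y') (g' : Y' ⟶ Z') (h' : Z' ⟶ X'⟦(1 : ℤ)⟧), D f g h → D f' g' h' →
    ∀ (a : X ⟶ X') (b : Y ⟶ Y'), f ≫ b = a ≫ f' →
    ∃ c : Z ⟶ Z', g ≫ c = b ≫ g' ∧ h ≫ a⟦(1 : ℤ)⟧' = c ≫ h'

namespace IsRightTriangulation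

variable {D : ∀ ⦃X Y Z : C⦄, (X ⟶ Y) → (Y ⟶ Z) → (Z ⟶ X⟦(1 : ℤ)⟧) → Prop}

lemma exists_comp_eq_of_comp_eq_zero (hD : IsRightTriangulation D) {X Y Z : C} {f : X ⟶ Y}
    {g : Y ⟶ Z} {h : Z ⟶ X⟦(1 : ℤ)⟧} (hT : D f g h) {W : C} (b : Y ⟶ W)
    (hb : f ≫ b = 0) : ∃ b' : Z ⟶ W, g ≫ b' = b := by
  let e : W⟦(-1 : ℤ)⟧⟦(1 : ℤ)⟧ ≅ W := (shiftEquiv C (1 : ℤ)).counitIso.app W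
  have h₀ := hD.rotate _ _ _ (hD.rotate _ _ _ (hD.contractible (W⟦(-1 : ℤ)⟧) _ (isZero_zero C)))
  obtain ⟨c, hc, -⟩ := hD.exists_hom _ _ _ _ _ _ hT h₀ 0 (b ≫ e.inv) (by
    rw [← Category.assoc, hb, zero_comp, zero_comp])
  refine ⟨-c ≫ e.hom, ?_⟩
  rw [CategoryTheory.Functor.map_id, Preadditive.comp_neg, Category.comp_id] at hc
  rw [Preadditive.comp_neg, ← Category.assoc, hc, Preadditive.neg_comp, neg_neg, Category.assoc,
    e.inv_hom_id, Category.comp_id]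

lemma isIso_of_comp_eq (hD : IsRightTriangulation D) {X Y Z : C} {f : X ⟶ Y} {g : Y ⟶ Z}
    {h : Z ⟶ X⟦(1 : ℤ)⟧} (hT : D f g h) (c : Z ⟶ Z) (h₁ : g ≫ c = g) (h₂ : c ≫ h = h) :
    IsIso c := by
  obtain ⟨a, ha⟩ := hD.exists_comp_eq_of_comp_eq_zero (hD.rotate _ _ _ hT) (c - 𝟙 Z)
    (by simp [h₁])
  -- `c - 𝟙` squares to zero because it factors through `h`
  have h₀ : c ≫ c = c + c - 𝟙 Z := by
    have : c ≫ (c - 𝟙 Z) = c - 𝟙 Z := by rw [← ha, reassoc_of% h₂]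
    rw [Preadditive.comp_sub, Category.comp_id, sub_eq_iff_eq_add] at this
    rw [this]
    abel
  refine ⟨𝟙 Z - (c - 𝟙 Z), ?_, ?_⟩
  · simp only [Preadditive.comp_sub, Category.comp_id, h₀]
    abel
  · simp only [Preadditive.sub_comp, Category.id_comp, h₀]
    abel

/-- The cone of a morphism is unique up to isomorphism. -/
lemma exists_iso_cocone (hD : IsRightTriangulation D) {X Y Z Z' : C} {f : X ⟶ Y} {g : Y ⟶ Z}
    {h : Z ⟶ X⟦(1 : ℤ)⟧} {g' : Y ⟶ Z'} {h' : Z' ⟶ X⟦(1 : ℤ)⟧} (hT : D f g h)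
    (hT' : D f g' h') : ∃ e : Z ≅ Z', g ≫ e.hom = g' ∧ e.hom ≫ h' = h := by
  obtain ⟨c, h₁, h₂⟩ := hD.exists_hom _ _ _ _ _ _ hT hT' (𝟙 X) (𝟙 Y) (by simp)
  obtain ⟨c', h₁', h₂'⟩ := hD.exists_hom _ _ _ _ _ _ hT' hT (𝟙 X) (𝟙 Y) (by simp)
  rw [CategoryTheory.Functor.map_id, Category.comp_id] at h₂ h₂'
  rw [Category.id_comp] at h₁ h₁'
  have i₁ := hD.isIso_of_comp_eq hT (c ≫ c') (by rw [reassoc_of% h₁, h₁'])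
    (by rw [Category.assoc, ← h₂', h₂])
  have i₂ := hD.isIso_of_comp_eq hT' (c' ≫ c) (by rw [reassoc_of% h₁', h₁])
    (by rw [Category.assoc, ← h₂, h₂'])
  have : IsSplitMono c := ⟨⟨⟨c' ≫ inv (c ≫ c'), by rw [← Category.assoc, IsIso.hom_inv_id]⟩⟩⟩
  have : Epi c := epi_of_epi c' c
  have : IsIso c := isIso_of_epi_of_isSplitMono c
  exact ⟨asIso c, h₁, h₂.symm⟩

lemma of_rotate (hD : IsRightTriangulation D) {X Y Z : C} {f : X ⟶ Y} {g : Y ⟶ Z}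
    {h : Z ⟶ X⟦(1 : ℤ)⟧} (hT : D g h (-f⟦(1 : ℤ)⟧')) : D f g h := by
  obtain ⟨Z', g', h', hT'⟩ := hD.exists_cocone f
  -- after rotation, both triangles start with the same morphism `-f⟦1⟧'`
  obtain ⟨e, h₁, h₂⟩ := hD.exists_iso_cocone (hD.rotate _ _ _ (hD.rotate _ _ _ hT))
    (hD.rotate _ _ _ (hD.rotate _ _ _ (hD.rotate _ _ _ hT')))
  refine hD.of_iso _ _ _ _ _ _ (Iso.refl _) (Iso.refl _)
    ((shiftFunctor C (1 : ℤ)).preimageIso e) (by simp) ?_ ?_ hT'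
  · apply (shiftFunctor C (1 : ℤ)).map_injective
    simpa using h₁
  · apply (shiftFunctor C (1 : ℤ)).map_injective
    simpa using h₂.symm

variable [∀ n : ℤ, (shiftFunctor C n).Additive]

/-- The pretriangulated structure given by a class of triangles stable under rotation in one
direction. -/
abbrev pretriangulated (hD : IsRightTriangulation D) : Pretriangulated C where
  distinguishedTriangles := {T | D T.mor₁ T.mor₂ T.mor₃}
  isomorphic_distinguished _ h _ e :=
    hD.of_iso _ _ _ _ _ _ (Triangle.π₁.mapIso e) (Triangle.π₂.mapIso e) (Triangle.π₃.mapIso e)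
      e.hom.comm₁ e.hom.comm₂ e.hom.comm₃ h
  contractible_distinguished X := hD.contractible X _ (isZero_zero C)
  distinguished_cocone_triangle := fun f ↦ hD.exists_cocone f
  rotate_distinguished_triangle _ := ⟨hD.rotate _ _ _, hD.of_rotate⟩
  complete_distinguished_triangle_morphism _ _ h₁ h₂ := hD.exists_hom _ _ _ _ _ _ h₁ h₂

end IsRightTriangulation

end

/-! ### Serre duality and vanishing of morphisms -/

section

variable {k : Type w} [Field k] {T : Type u} [Category.{v} T] [Preadditive T] [Linear k T]

lemma SerreFunctor.duality_apply (S : SerreFunctor k T) {A B : T} (f : A ⟶ B)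
    (g : B ⟶ S.functor.obj A) : S.duality A B f g = S.duality A A (𝟙 A) (f ≫ g) := by
  rw [← S.duality_comp_right, Category.id_comp]

/-- A morphism to `S Y` is determined by the functionals given by composition with morphisms
from `Y`, because all functionals are of this form. -/
lemma SerreFunctor.eq_zero_of_precomp (S : SerreFunctor k T) {A Y : T}
    (δ : A ⟶ S.functor.obj Y) (h : ∀ f : Y ⟶ A, f ≫ δ = 0) : δ = 0 := by
  rw [← Module.forall_dual_apply_eq_zero_iff k]
  intro φ
  obtain ⟨f, rfl⟩ := (S.duality Y A).surjective φ
  rw [S.duality_apply, h, map_zero]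

lemma SerreFunctor.eq_zero_of_postcomp (S : SerreFunctor k T) {A B : T}
    (δ : A ⟶ B) (h : ∀ g : B ⟶ S.functor.obj A, δ ≫ g = 0) : δ = 0 := by
  apply (S.duality A B).injective
  ext g
  rw [S.duality_apply, h, map_zero, map_zero, LinearMap.zero_apply]

/-- The canonical isomorphism `Σ τ Y ≅ S Y`. -/
def SerreFunctor.shiftTauIso [HasShift T ℤ] (S : SerreFunctor k T) (Y : T) :
    (S.tau.obj Y)⟦(1 : ℤ)⟧ ≅ S.functor.obj Y :=
  (shiftEquiv T (1 : ℤ)).counitIso.app (S.functor.obj Y)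

/-- A morphism `P ⟶ Σ M` is killed by all morphisms from `Y` if and only if it is killed by the
suspensions of all morphisms to `τ Y`. -/
lemma SerreFunctor.forall_comp_eq_zero_iff [HasShift T ℤ] (S : SerreFunctor k T) {P M : T}
    (δ : P ⟶ M⟦(1 : ℤ)⟧) (Y : T) :
    (∀ f : Y ⟶ P, f ≫ δ = 0) ↔ ∀ g : M ⟶ S.tau.obj Y, δ ≫ g⟦(1 : ℤ)⟧' = 0 := by
  constructor
  · intro h g
    rw [← cancel_mono (S.shiftTauIso Y).hom, zero_comp]
    apply S.eq_zero_of_precomp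
    intro f
    rw [Category.assoc, reassoc_of% (h f), zero_comp]
  · intro h f
    apply S.eq_zero_of_postcomp
    intro g
    obtain ⟨g', hg'⟩ := (shiftFunctor T (1 : ℤ)).map_surjective (g ≫ (S.shiftTauIso Y).inv)
    rw [← cancel_mono (S.shiftTauIso Y).inv, Category.assoc, Category.assoc, ← hg', h, comp_zero,
      zero_comp]

end

/-! ### Approximations and distinguished triangles -/

section

variable {T : Type u} [Category.{v} T] [Preadditive T] [HasZeroObject T] [HasShift T ℤ]
  [∀ n : ℤ, (shiftFunctor T n).Additive] [Pretriangulated T]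

section

variable {M N P : T} {μ : M ⟶ N} {ν : N ⟶ P} {δ : P ⟶ M⟦(1 : ℤ)⟧}
  (hT : Triangle.mk μ ν δ ∈ distTriang T)

include hT

lemma exists_of_comp_shift_eq_zero {X : T} (g : M ⟶ X) (hg : δ ≫ g⟦(1 : ℤ)⟧' = 0) :
    ∃ h : N ⟶ X, μ ≫ h = g := by
  obtain ⟨d, hd⟩ : ∃ d : N⟦(1 : ℤ)⟧ ⟶ X⟦(1 : ℤ)⟧, g⟦(1 : ℤ)⟧' = (-μ⟦(1 : ℤ)⟧') ≫ d :=
    Triangle.yoneda_exact₃ _ (rot_of_distTriang _ hT) (g⟦(1 : ℤ)⟧') hg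
  obtain ⟨d', rfl⟩ := (shiftFunctor T (1 : ℤ)).map_surjective d
  refine ⟨-d', (shiftFunctor T (1 : ℤ)).map_injective ?_⟩
  rw [hd, Functor.map_comp, Functor.map_neg, Preadditive.comp_neg, Preadditive.neg_comp]

lemma exists_of_comp_eq_zero {X : T} (f : X ⟶ P) (hf : f ≫ δ = 0) : ∃ h : X ⟶ N, h ≫ ν = f := by
  obtain ⟨h, hh⟩ := Triangle.coyoneda_exact₃ _ hT f hf
  exact ⟨h, hh.symm⟩

lemma exists_of_comp_mor₂_eq_zero {X : T} (f : N ⟶ X) (hf : μ ≫ f = 0) :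
    ∃ h : P ⟶ X, ν ≫ h = f := by
  obtain ⟨h, hh⟩ := Triangle.yoneda_exact₂ _ hT f hf
  exact ⟨h, hh.symm⟩

lemma mor₃_comp_shift_mor₁ : δ ≫ μ⟦(1 : ℤ)⟧' = 0 := comp_distTriang_mor_zero₃₁ _ hT

lemma mor₂_comp_mor₃ : ν ≫ δ = 0 := comp_distTriang_mor_zero₂₃ _ hT

lemma isXMono_iff (𝕏 : ObjectProperty T) :
    IsXMono 𝕏 μ ↔ ∀ ⦃X : T⦄, 𝕏 X → ∀ g : M ⟶ X, δ ≫ g⟦(1 : ℤ)⟧' = 0 := by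
  refine ⟨fun h X hX g ↦ ?_, fun h X hX g ↦ exists_of_comp_shift_eq_zero hT g (h hX g)⟩
  obtain ⟨g', rfl⟩ := h hX g
  rw [Functor.map_comp, reassoc_of% (mor₃_comp_shift_mor₁ hT), zero_comp]

lemma isXEpi_iff (𝕏 : ObjectProperty T) :
    IsXEpi 𝕏 ν ↔ ∀ ⦃X : T⦄, 𝕏 X → ∀ f : X ⟶ P, f ≫ δ = 0 := by
  refine ⟨fun h X hX f ↦ ?_, fun h X hX f ↦ exists_of_comp_eq_zero hT f (h hX f)⟩
  obtain ⟨f', rfl⟩ := h hX f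
  rw [Category.assoc, mor₂_comp_mor₃ hT, comp_zero]

/-- If `τ 𝕏 = 𝕏`, then in each distinguished triangle the first morphism is an `𝕏`-monomorphism
if and only if the second one is an `𝕏`-epimorphism. -/
lemma isXMono_iff_isXEpi {k : Type w} [Field k] [Linear k T] (S : SerreFunctor k T)
    (𝕏 : ObjectProperty T) (h𝕏 : 𝕏.map S.tau = 𝕏) : IsXMono 𝕏 μ ↔ IsXEpi 𝕏 ν := by
  rw [isXMono_iff hT, isXEpi_iff hT]
  constructor
  · intro h Y hY
    exact (S.forall_comp_eq_zero_iff δ Y).2 (h (by rw [← h𝕏]; exact 𝕏.prop_map_obj _ hY))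
  · intro h X hX g
    rw [← h𝕏] at hX
    obtain ⟨Y, hY, ⟨e⟩⟩ := hX
    rw [← cancel_mono (e.inv⟦(1 : ℤ)⟧'), zero_comp, Category.assoc, ← Functor.map_comp]
    exact (S.forall_comp_eq_zero_iff δ Y).1 (h hY) _

end

lemma distinguished_rotate_iff {A B D : T} {f : A ⟶ B} {g : B ⟶ D} {h : D ⟶ A⟦(1 : ℤ)⟧} :
    Triangle.mk f g h ∈ distTriang T ↔ Triangle.mk g h (-f⟦(1 : ℤ)⟧') ∈ distTriang T :=
  rotate_distinguished_triangle _

lemma distinguished_of_iso {A B D A' B' D' : T} {f : A ⟶ B} {g : B ⟶ D} {h : D ⟶ A⟦(1 : ℤ)⟧}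
    {f' : A' ⟶ B'} {g' : B' ⟶ D'} {h' : D' ⟶ A'⟦(1 : ℤ)⟧} (a : A ≅ A') (b : B ≅ B') (d : D ≅ D')
    (h₁ : f ≫ b.hom = a.hom ≫ f') (h₂ : g ≫ d.hom = b.hom ≫ g')
    (h₃ : h ≫ a.hom⟦(1 : ℤ)⟧' = d.hom ≫ h') (hT : Triangle.mk f' g' h' ∈ distTriang T) :
    Triangle.mk f g h ∈ distTriang T :=
  isomorphic_distinguished _ hT _ (Triangle.isoMk _ _ a b d h₁ h₂ h₃)

lemma exists_iso_of_distinguished {A B D D' : T} {f : A ⟶ B} {g : B ⟶ D} {h : D ⟶ A⟦(1 : ℤ)⟧}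
    {g' : B ⟶ D'} {h' : D' ⟶ A⟦(1 : ℤ)⟧} (hT : Triangle.mk f g h ∈ distTriang T)
    (hT' : Triangle.mk f g' h' ∈ distTriang T) :
    ∃ e : D ≅ D', g ≫ e.hom = g' ∧ e.hom ≫ h' = h := by
  let e := isoTriangleOfIso₁₂ _ _ hT hT' (Iso.refl _) (Iso.refl _)
    ((Category.comp_id _).trans (Category.id_comp _).symm)
  have h₂ := e.hom.comm₂
  have h₃ := e.hom.comm₃
  refine ⟨Triangle.π₃.mapIso e, h₂.trans (Category.id_comp _), h₃.symm.trans ?_⟩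
  change h ≫ (𝟙 A)⟦(1 : ℤ)⟧' = h
  rw [CategoryTheory.Functor.map_id, Category.comp_id]

/-- If a distinguished triangle `(μ, ν, δ)` starting at `M` maps to a distinguished triangle
`(ι, p, ε)` by a morphism whose first component is the identity, then the homotopy cocartesian
square formed by the other components yields a distinguished triangle. -/
lemma exists_distinguished_biprod [IsTriangulated T] {M N P X Q : T} {μ : M ⟶ N} {ν : N ⟶ P}
    {δ : P ⟶ M⟦(1 : ℤ)⟧} (hT : Triangle.mk μ ν δ ∈ distTriang T) {ι : M ⟶ X} {p : X ⟶ Q}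
    {ε : Q ⟶ M⟦(1 : ℤ)⟧} (hT' : Triangle.mk ι p ε ∈ distTriang T) (π : P ⟶ Q)
    (hπ : π ≫ ε = δ) :
    ∃ n : N ⟶ X, Triangle.mk (biprod.lift ν n) (biprod.desc π p) (-ε ≫ μ⟦(1 : ℤ)⟧') ∈
      distTriang T := by
  obtain ⟨Z, θ, w, hZ⟩ := distinguished_cocone_triangle (biprod.desc π p)
  have h₁₂ : Triangle.mk (biprod.inr : X ⟶ P ⊞ X) biprod.fst (0 : P ⟶ X⟦(1 : ℤ)⟧) ∈
      distTriang T :=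
    distinguished_of_iso (Iso.refl _) (biprod.braiding P X) (Iso.refl _)
      (by apply biprod.hom_ext <;> simp) (by simp) (by simp)
      (binaryBiproductTriangle_distinguished X P)
  -- the octahedral axiom for `X ⟶ P ⊞ X ⟶ Q` compares the cone `Z` with the rotation
  -- `P ⟶ Σ M ⟶ Σ N` of the first triangle
  obtain ⟨⟨m₁, m₃, comm₁, comm₂, comm₃, comm₄, mem⟩⟩ := IsTriangulated.octahedron_axiom
    (u₁₂ := (biprod.inr : X ⟶ P ⊞ X)) (u₂₃ := biprod.desc π p) (u₁₃ := p) (by simp) h₁₂ hZ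
    (distinguished_rotate_iff.1 hT')
  have hm₁ : m₁ = δ := by
    rw [← biprod.inl_fst_assoc (Y := X) m₁, comm₁, biprod.inl_desc_assoc, hπ]
  rw [hm₁] at mem
  obtain ⟨e, h₁, h₂⟩ := exists_iso_of_distinguished mem
    (distinguished_rotate_iff.1 (distinguished_rotate_iff.1 hT))
  obtain ⟨κ, hκ⟩ := (shiftFunctor T (1 : ℤ)).map_surjective (e.inv ≫ w)
  have hfst : κ ≫ biprod.fst = -ν := by
    apply (shiftFunctor T (1 : ℤ)).map_injective
    rw [Functor.map_comp, hκ, Functor.map_neg, Category.assoc, Iso.inv_comp_eq, h₂]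
  refine ⟨-(κ ≫ biprod.snd), distinguished_rotate_iff.2 ?_⟩
  have hlift : biprod.lift ν (-(κ ≫ biprod.snd)) = -κ := by
    apply biprod.hom_ext
    · rw [biprod.lift_fst, Preadditive.neg_comp, hfst, neg_neg]
    · rw [biprod.lift_snd, Preadditive.neg_comp]
  rw [hlift, Functor.map_neg, neg_neg, hκ]
  refine distinguished_of_iso (Iso.refl _) (Iso.refl _) e.symm ?_ ?_ ?_ hZ
  · simp
  · rw [← comm₃, Iso.refl_hom, Category.id_comp, ← Preadditive.comp_neg, ← h₁]
    simp
  · simp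

/-- A retract of an object is a direct summand. -/
lemma IsAdmissible.of_retract {𝕏 : ObjectProperty T} [IsAdmissible 𝕏] {M X : T} {i : M ⟶ X}
    {r : X ⟶ M} (h : i ≫ r = 𝟙 M) (hX : 𝕏 X) : 𝕏 M := by
  obtain ⟨Q, p, ε, hT⟩ := distinguished_cocone_triangle i
  have hε : ε = 0 := by
    have := mor₃_comp_shift_mor₁ hT
    rw [← Category.comp_id ε, ← CategoryTheory.Functor.map_id, ← h, Functor.map_comp,
      reassoc_of% this, zero_comp]
  obtain ⟨e, -, -⟩ := exists_iso_binaryBiproduct_of_distTriang _ hT hε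
  exact IsAdmissible.of_biprod (IsAdmissible.of_iso e hX)

end

/-! ### Morphisms of the quotient category -/

section

variable {T : Type u} [Category.{v} T] [Preadditive T] [HasBinaryBiproducts T]
  (𝕏 : ObjectProperty T) [IsAdmissible 𝕏]

lemma toQuotient_map_eq_iff {M N : T} (f g : M ⟶ N) :
    (toQuotient 𝕏).map f = (toQuotient 𝕏).map g ↔ FactorsThrough 𝕏 (f - g) :=
  CategoryTheory.Quotient.functor_map_eq_iff _ _ _

variable {𝕏}

lemma toQuotient_map_eq_zero {M X N : T} (hX : 𝕏 X) (a : M ⟶ X) (b : X ⟶ N) :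
    (toQuotient 𝕏).map (a ≫ b) = 0 := by
  rw [← (toQuotient 𝕏).map_zero, toQuotient_map_eq_iff]
  exact ⟨X, hX, a, b, by simp⟩

lemma isZero_toQuotient_obj {X : T} (hX : 𝕏 X) : IsZero ((toQuotient 𝕏).obj X) := by
  rw [IsZero.iff_id_eq_zero, ← (toQuotient 𝕏).map_id, ← Category.comp_id (𝟙 X)]
  exact toQuotient_map_eq_zero hX _ _

end

namespace ApproximationTriangles

variable {T : Type u} [Category.{v} T] [Preadditive T] [HasZeroObject T] [HasShift T ℤ]
  [∀ n : ℤ, (shiftFunctor T n).Additive] [Pretriangulated T]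
  {𝕏 : ObjectProperty T} (c : ApproximationTriangles 𝕏)

lemma envδ_comp_shift {M X : T} (hX : 𝕏 X) (g : M ⟶ X) : c.envδ M ≫ g⟦(1 : ℤ)⟧' = 0 :=
  (isXMono_iff (c.env_dist M) 𝕏).1 (c.isPreenvelope M).2 hX g

lemma comp_covδ {M X : T} (hX : 𝕏 X) (f : X ⟶ M) : f ≫ c.covδ M = 0 :=
  (isXEpi_iff (c.cov_dist M) 𝕏).1 (c.isPrecover M).2 hX f

/-- An `𝕏`-monomorphism completed to a distinguished triangle maps to the chosen triangle. -/
lemma exists_hom_env {M N P : T} {μ : M ⟶ N} {ν : N ⟶ P} {δ : P ⟶ M⟦(1 : ℤ)⟧}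
    (hT : Triangle.mk μ ν δ ∈ distTriang T) (hμ : IsXMono 𝕏 μ) :
    ∃ (n : N ⟶ c.env M) (π : P ⟶ c.sigma M), μ ≫ n = c.envι M ∧ ν ≫ π = n ≫ c.envπ M ∧
      π ≫ c.envδ M = δ := by
  obtain ⟨n, hn⟩ := hμ (c.isPreenvelope M).1 (c.envι M)
  obtain ⟨π, h₁, h₂⟩ : ∃ π : P ⟶ c.sigma M, ν ≫ π = n ≫ c.envπ M ∧
      δ ≫ (𝟙 M)⟦(1 : ℤ)⟧' = π ≫ c.envδ M :=
    complete_distinguished_triangle_morphism _ _ hT (c.env_dist M) (𝟙 M) n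
      (hn.trans (Category.id_comp _).symm)
  exact ⟨n, π, hn, h₁, by rw [← h₂, CategoryTheory.Functor.map_id, Category.comp_id]⟩

/-- An `𝕏`-epimorphism completed to a distinguished triangle receives a morphism from the chosen
triangle. -/
lemma exists_hom_cov {L M N : T} {l : L ⟶ M} {μ : M ⟶ N} {δ : N ⟶ L⟦(1 : ℤ)⟧}
    (hT : Triangle.mk l μ δ ∈ distTriang T) (hμ : IsXEpi 𝕏 μ) :
    ∃ (n : c.cov N ⟶ M) (π : c.omega N ⟶ L), n ≫ μ = c.covπ N ∧ π ≫ l = c.covι N ≫ n ∧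
      c.covδ N ≫ π⟦(1 : ℤ)⟧' = δ := by
  obtain ⟨n, hn⟩ := hμ (c.isPrecover N).1 (c.covπ N)
  obtain ⟨π, h₁, h₂⟩ : ∃ π : c.omega N ⟶ L, c.covι N ≫ n = π ≫ l ∧
      c.covδ N ≫ π⟦(1 : ℤ)⟧' = 𝟙 N ≫ δ :=
    complete_distinguished_triangle_morphism₁ _ _ (c.cov_dist N) hT n (𝟙 N)
      ((Category.comp_id _).trans hn.symm)
  exact ⟨n, π, hn, h₁.symm, h₂.trans (Category.id_comp _)⟩

variable [IsAdmissible 𝕏]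

/-- The class of a morphism to `σ M` is determined by its composition with `σ M ⟶ Σ M`. -/
lemma toQuotient_map_eq_of_comp_envδ {P M : T} {π π' : P ⟶ c.sigma M}
    (h : π ≫ c.envδ M = π' ≫ c.envδ M) : (toQuotient 𝕏).map π = (toQuotient 𝕏).map π' := by
  rw [toQuotient_map_eq_iff]
  obtain ⟨d, hd⟩ := exists_of_comp_eq_zero (c.env_dist M) (π - π') (by
    rw [Preadditive.sub_comp, h, sub_self])
  exact ⟨_, (c.isPreenvelope M).1, d, c.envπ M, hd⟩

/-- The standard right-triangles. -/
lemma rightDistinguished_of_distinguished {M N P : T} {μ : M ⟶ N} {ν : N ⟶ P}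
    {δ : P ⟶ M⟦(1 : ℤ)⟧} (hT : Triangle.mk μ ν δ ∈ distTriang T) (hμ : IsXMono 𝕏 μ)
    {π : P ⟶ c.sigma M} (hπ : π ≫ c.envδ M = δ) :
    c.RightDistinguished ((toQuotient 𝕏).map μ) ((toQuotient 𝕏).map ν) (c.toSigma π) := by
  obtain ⟨n, π', h₁, h₂, h₃⟩ := c.exists_hom_env hT hμ
  refine ⟨M, N, P, μ, ν, δ, n, π', hμ, hT, h₁, h₂, h₃, Iso.refl _, Iso.refl _, Iso.refl _,
    by simp, by simp, ?_⟩
  simp only [Iso.refl_hom, CategoryTheory.Functor.map_id, Category.comp_id, Category.id_comp]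
  exact c.toQuotient_map_eq_of_comp_envδ (hπ.trans h₃.symm)

/-! ### Consequences of a triangulated structure -/

section

variable {c} (hc : c.pretriangulatedData.IsTriangulatedStructure)

include hc

lemma isIso_toQuotient_map {M N P : T} {μ : M ⟶ N} {ν : N ⟶ P} {δ : P ⟶ M⟦(1 : ℤ)⟧}
    (hT : Triangle.mk μ ν δ ∈ distTriang T) (hμ : IsXMono 𝕏 μ) (hP : 𝕏 P) :
    IsIso ((toQuotient 𝕏).map μ) := by
  obtain ⟨n, π, -, -, hπ⟩ := c.exists_hom_env hT hμ
  obtain ⟨_, _, _, _, e, _, hr, -⟩ := hc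
  have := (hr _ _ _).1 (c.rightDistinguished_of_distinguished hT hμ hπ)
  exact (Triangle.isZero₃_iff_isIso₁ _ this).1 (isZero_toQuotient_obj hP)

/-- If the quotient is triangulated, then `X_M ⟶ σ M` is an `𝕏`-epimorphism. -/
lemma comp_envδ {M X : T} (hX : 𝕏 X) (f : X ⟶ c.sigma M) : f ≫ c.envδ M = 0 := by
  -- `μ : M ⟶ N` is the fibre of the composition `X^{σ M} ⟶ σ M ⟶ Σ M`; it is an isomorphism
  -- in the quotient category
  obtain ⟨N, μ, ν, hT⟩ := distinguished_cocone_triangle₂ (c.covπ (c.sigma M) ≫ c.envδ M)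
  have hμ : IsXMono 𝕏 μ := (isXMono_iff hT 𝕏).2 fun Y hY g ↦ by
    rw [Category.assoc, c.envδ_comp_shift hY, comp_zero]
  have := isIso_toQuotient_map hc hT hμ (c.isPrecover _).1
  obtain ⟨v, hv⟩ := (toQuotient 𝕏).map_surjective (inv ((toQuotient 𝕏).map μ))
  have hv' : (toQuotient 𝕏).map (𝟙 M) = (toQuotient 𝕏).map (μ ≫ v) := by
    rw [Functor.map_comp, hv, IsIso.hom_inv_id, CategoryTheory.Functor.map_id]
  obtain ⟨Y, hY, a, b, hab⟩ := (toQuotient_map_eq_iff 𝕏 _ _).1 hv'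
  obtain ⟨f', rfl⟩ := (c.isPrecover (c.sigma M)).2 hX f
  rw [eq_comm, sub_eq_iff_eq_add] at hab
  have h₀ := mor₃_comp_shift_mor₁ hT
  rw [Category.assoc] at h₀
  rw [← Category.comp_id (c.envδ M), ← CategoryTheory.Functor.map_id, hab, Functor.map_add,
    Functor.map_comp, Functor.map_comp, Preadditive.comp_add,
    reassoc_of% (c.envδ_comp_shift hY a), zero_comp, zero_add, Category.assoc,
    reassoc_of% h₀, zero_comp, comp_zero]

/-- If the quotient is triangulated, then a morphism `N ⟶ Σ X` with `X` in `𝕏` is zero as soon as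
it is killed by all morphisms from `𝕏`. -/
lemma eq_zero_of_forall_comp_eq_zero {N X : T} (hX : 𝕏 X) (φ : N ⟶ X⟦(1 : ℤ)⟧)
    (hφ : ∀ ⦃Y : T⦄, 𝕏 Y → ∀ f : Y ⟶ N, f ≫ φ = 0) : φ = 0 := by
  -- `N` is isomorphic to some `σ M` in the quotient, and the statement is clear for `σ M`
  obtain ⟨M, ⟨i⟩⟩ : ∃ M : T, Nonempty ((toQuotient 𝕏).obj (c.sigma M) ≅ (toQuotient 𝕏).obj N) := by
    obtain ⟨_, _, _, _, e, _, -, -⟩ := hc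
    let M' := ((toQuotient 𝕏).obj N)⟦(-1 : ℤ)⟧
    exact ⟨M'.as, ⟨(e.app M').symm ≪≫ (shiftEquiv _ (1 : ℤ)).counitIso.app _⟩⟩
  obtain ⟨f, hf⟩ := (toQuotient 𝕏).map_surjective i.inv
  obtain ⟨g, hg⟩ := (toQuotient 𝕏).map_surjective i.hom
  have hfg : (toQuotient 𝕏).map (𝟙 N) = (toQuotient 𝕏).map (f ≫ g) := by
    rw [Functor.map_comp, hf, hg, i.inv_hom_id, CategoryTheory.Functor.map_id]
  obtain ⟨Y, hY, a, b, hab⟩ := (toQuotient_map_eq_iff 𝕏 _ _).1 hfg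
  have h₀ : g ≫ φ = 0 := by
    obtain ⟨h, hh⟩ := exists_of_comp_mor₂_eq_zero (distinguished_rotate_iff.1 (c.env_dist M))
      (g ≫ φ) (by rw [← Category.assoc]; exact hφ (c.isPreenvelope M).1 _)
    obtain ⟨h', rfl⟩ := (shiftFunctor T (1 : ℤ)).map_surjective h
    rw [← hh, c.envδ_comp_shift hX]
  rw [eq_comm, sub_eq_iff_eq_add] at hab
  rw [← Category.id_comp φ, hab, Preadditive.add_comp, Category.assoc, Category.assoc, hφ hY b,
    h₀, comp_zero, comp_zero, add_zero]

/-- If the quotient is triangulated, then `τ 𝕏 = 𝕏`. -/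
lemma map_tau_eq_of_isTriangulatedStructure {k : Type w} [Field k] [Linear k T]
    (S : SerreFunctor k T) : 𝕏.map S.tau = 𝕏 := by
  ext Y
  constructor
  · rintro ⟨X, hX, ⟨i⟩⟩
    refine IsAdmissible.of_iso i ?_
    -- the preenvelope of `τ X` splits, because its third morphism vanishes by Serre duality
    have h₀ : c.envδ (S.tau.obj X) = 0 := by
      rw [← cancel_mono (S.shiftTauIso X).hom, zero_comp]
      refine S.eq_zero_of_precomp _ fun f ↦ ?_
      rw [← Category.assoc, comp_envδ hc hX, zero_comp]
    obtain ⟨r, hr⟩ := exists_of_comp_shift_eq_zero (c.env_dist (S.tau.obj X)) (𝟙 _)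
      (by rw [h₀, zero_comp])
    exact IsAdmissible.of_retract hr (c.isPreenvelope _).1
  · intro hY
    have := S.isEquivalence
    let Z := S.functor.objPreimage (Y⟦(1 : ℤ)⟧)
    let i : S.functor.obj Z ≅ Y⟦(1 : ℤ)⟧ := S.functor.objObjPreimageIso _
    have h₀ : c.covδ Z = 0 := by
      refine S.eq_zero_of_postcomp _ fun g ↦ ?_
      rw [← cancel_mono i.hom, zero_comp]
      refine eq_zero_of_forall_comp_eq_zero hc hY _ fun X hX f ↦ ?_
      rw [Category.assoc, ← Category.assoc, c.comp_covδ hX, zero_comp]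
    obtain ⟨s, hs⟩ := exists_of_comp_eq_zero (c.cov_dist Z) (𝟙 _) (by rw [h₀, comp_zero])
    exact ⟨Z, IsAdmissible.of_retract hs (c.isPrecover _).1,
      ⟨(shiftFunctor T (1 : ℤ)).preimageIso (S.shiftTauIso Z ≪≫ i)⟩⟩

end

end ApproximationTriangles

/-! ### The axioms of right-triangles -/

section

variable {T : Type u} [Category.{v} T] [Preadditive T] [HasBinaryBiproducts T]
  (𝕏 : ObjectProperty T) [IsAdmissible 𝕏]

instance quotientHasBinaryBiproducts : HasBinaryBiproducts (QuotientCat 𝕏) where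
  has_binary_biproduct A B := by
    have := preservesBinaryBiproducts_of_preservesBiproducts (toQuotient 𝕏)
    exact Functor.hasBinaryBiproduct_of_preserves (toQuotient 𝕏) A.as B.as

variable {𝕏}

/-- In the quotient category, adding a direct summand in `𝕏` does not change an object. -/
@[simps]
noncomputable def toQuotientBiprodIso {X : T} (hX : 𝕏 X) (M : T) :
    (toQuotient 𝕏).obj M ≅ (toQuotient 𝕏).obj (M ⊞ X) where
  hom := (toQuotient 𝕏).map biprod.inl
  inv := (toQuotient 𝕏).map biprod.fst
  hom_inv_id := by rw [← Functor.map_comp, biprod.inl_fst, CategoryTheory.Functor.map_id]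
  inv_hom_id := by
    rw [← Functor.map_comp, ← CategoryTheory.Functor.map_id, ← biprod.total, Functor.map_add,
      toQuotient_map_eq_zero hX biprod.snd biprod.inr, add_zero]

end

namespace ApproximationTriangles

variable {T : Type u} [Category.{v} T] [Preadditive T] [HasZeroObject T] [HasShift T ℤ]
  [∀ n : ℤ, (shiftFunctor T n).Additive] [Pretriangulated T]
  {𝕏 : ObjectProperty T} (c : ApproximationTriangles 𝕏) [IsAdmissible 𝕏]

variable {c} in
lemma RightDistinguished.of_iso {A B D A' B' D' : QuotientCat 𝕏} {f : A ⟶ B} {g : B ⟶ D}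
    {h : D ⟶ c.sigmaFunctor.obj A} {f' : A' ⟶ B'} {g' : B' ⟶ D'}
    {h' : D' ⟶ c.sigmaFunctor.obj A'} (H : c.RightDistinguished f' g' h') (a : A ≅ A')
    (b : B ≅ B') (d : D ≅ D') (h₁ : f ≫ b.hom = a.hom ≫ f') (h₂ : g ≫ d.hom = b.hom ≫ g')
    (h₃ : h ≫ c.sigmaFunctor.map a.hom = d.hom ≫ h') : c.RightDistinguished f g h := by
  obtain ⟨M, N, P, μ, ν, δ, n, π, hμ, hT, hn, hν, hπ, a', b', d', h₁', h₂', h₃'⟩ := H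
  refine ⟨M, N, P, μ, ν, δ, n, π, hμ, hT, hn, hν, hπ, a ≪≫ a', b ≪≫ b', d ≪≫ d', ?_, ?_, ?_⟩
  · rw [Iso.trans_hom, Iso.trans_hom, reassoc_of% h₁, h₁', Category.assoc]
  · rw [Iso.trans_hom, Iso.trans_hom, reassoc_of% h₂, h₂', Category.assoc]
  · rw [Iso.trans_hom, Iso.trans_hom, Functor.map_comp, reassoc_of% h₃, h₃', Category.assoc]

lemma map_comp_toSigma {P P' M : T} (f : P ⟶ P') (π : P' ⟶ c.sigma M) :
    (toQuotient 𝕏).map f ≫ c.toSigma π = c.toSigma (f ≫ π) :=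
  ((toQuotient 𝕏).map_comp f π).symm

lemma rightDistinguished_contractible (A Z : QuotientCat 𝕏) (hZ : IsZero Z) :
    c.RightDistinguished (𝟙 A) (0 : A ⟶ Z) 0 := by
  have H := c.rightDistinguished_of_distinguished (π := 0)
    (contractible_distinguished A.as) (fun X _ g ↦ ⟨g, Category.id_comp g⟩) zero_comp
  refine H.of_iso (Iso.refl _) (Iso.refl _)
    (hZ.iso ((toQuotient 𝕏).map_isZero (isZero_zero T))) ?_ ?_ ?_
  · rw [CategoryTheory.Functor.map_id]
    rfl
  · exact ((toQuotient 𝕏).map_isZero (isZero_zero T)).eq_of_tgt _ _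
  · exact hZ.eq_of_src _ _

/-- Every morphism of the quotient category is represented by an `𝕏`-monomorphism, after adding a
summand in `𝕏` to its target. -/
lemma exists_isXMono (c : ApproximationTriangles 𝕏) {A B : QuotientCat 𝕏} (f : A ⟶ B) :
    ∃ (N : T) (μ : A.as ⟶ N) (b : B ≅ (toQuotient 𝕏).obj N), IsXMono 𝕏 μ ∧
      f ≫ b.hom = (toQuotient 𝕏).map μ := by
  obtain ⟨μ, hμ⟩ : ∃ μ : A.as ⟶ B.as, (toQuotient 𝕏).map μ = f :=
    (toQuotient 𝕏).map_surjective f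
  let b : B ≅ (toQuotient 𝕏).obj (B.as ⊞ c.env A.as) :=
    toQuotientBiprodIso (c.isPreenvelope A.as).1 B.as
  refine ⟨B.as ⊞ c.env A.as, biprod.lift μ (c.envι A.as), b, fun X hX g ↦ ?_, ?_⟩
  · obtain ⟨h, rfl⟩ := (c.isPreenvelope A.as).2 hX g
    exact ⟨biprod.snd ≫ h, by rw [biprod.lift_snd_assoc]⟩
  · rw [← Iso.eq_comp_inv, ← hμ]
    change _ = (toQuotient 𝕏).map _ ≫ (toQuotient 𝕏).map biprod.fst
    rw [← Functor.map_comp, biprod.lift_fst]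

lemma exists_rightDistinguished {A B : QuotientCat 𝕏} (f : A ⟶ B) :
    ∃ (D : QuotientCat 𝕏) (g : B ⟶ D) (h : D ⟶ c.sigmaFunctor.obj A),
      c.RightDistinguished f g h := by
  obtain ⟨N, μ, b, hμ, hf⟩ := c.exists_isXMono f
  obtain ⟨P, ν, δ, hT⟩ := distinguished_cocone_triangle μ
  obtain ⟨n, π, -, -, hπ⟩ := c.exists_hom_env hT hμ
  refine ⟨(toQuotient 𝕏).obj P, b.hom ≫ (toQuotient 𝕏).map ν, c.toSigma π,
    (c.rightDistinguished_of_distinguished hT hμ hπ).of_iso (Iso.refl _) b (Iso.refl _) ?_ ?_ ?_⟩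
  · rw [hf]
    exact (Category.id_comp _).symm
  · rw [Iso.refl_hom, Category.comp_id]
  · rw [Iso.refl_hom, Iso.refl_hom, Category.id_comp]
    exact (congrArg _ (c.sigmaFunctor.map_id _)).trans (Category.comp_id _)

variable {c} in
/-- Rotation of right-triangles. The morphism `ν` need not be an `𝕏`-monomorphism, but it becomes
one after adding the component `N ⟶ X_M` of a homotopy cocartesian square. -/
lemma RightDistinguished.rotate [IsTriangulated T] {A B D : QuotientCat 𝕏} {f : A ⟶ B}
    {g : B ⟶ D} {h : D ⟶ c.sigmaFunctor.obj A} (H : c.RightDistinguished f g h) :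
    c.RightDistinguished g h (-c.sigmaFunctor.map f) := by
  obtain ⟨M, N, P, μ, ν, δ, n, π, hμ, hT, hn, hν, hπ, a, b, d, h₁, h₂, h₃⟩ := H
  obtain ⟨n', hT'⟩ := exists_distinguished_biprod hT (c.env_dist M) π hπ
  have hμ' : IsXMono 𝕏 (biprod.lift ν n') := (isXMono_iff hT' 𝕏).2 fun X hX g ↦ by
    rw [Preadditive.neg_comp, Category.assoc, ← Functor.map_comp, c.envδ_comp_shift hX, neg_zero]
  obtain ⟨s, hs⟩ := c.exists_sigmaLift μ
  have hsσ := c.sigmaFunctor_map hs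
  obtain ⟨-, -, -, hs⟩ := hs
  have hs' : -c.sigmaFunctor.map ((toQuotient 𝕏).map μ) = c.toSigma (-s) := by
    rw [hsσ]
    exact (toQuotient 𝕏).map_neg.symm
  have H' : c.RightDistinguished ((toQuotient 𝕏).map (biprod.lift ν n'))
      (c.toSigma (biprod.desc π (c.envπ M))) (-c.sigmaFunctor.map ((toQuotient 𝕏).map μ)) := by
    rw [hs']
    exact c.rightDistinguished_of_distinguished hT' hμ' (by rw [Preadditive.neg_comp, hs])
  refine H'.of_iso b (d ≪≫ toQuotientBiprodIso (c.isPreenvelope M).1 P)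
    (c.sigmaFunctor.mapIso a) ?_ ?_ ?_
  · rw [Iso.trans_hom, reassoc_of% h₂]
    congr 1
    rw [← Iso.eq_comp_inv, toQuotientBiprodIso_inv, ← Functor.map_comp, biprod.lift_fst]
  · rw [Functor.mapIso_hom, h₃, Iso.trans_hom, Category.assoc, toQuotientBiprodIso_hom,
      c.map_comp_toSigma, biprod.inl_desc]
  · rw [Functor.mapIso_hom, Preadditive.neg_comp, Preadditive.comp_neg, ← Functor.map_comp,
      ← Functor.map_comp, h₁]

lemma toSigma_comp_sigmaFunctor_map {P P' M M' : T} {π : P ⟶ c.sigma M} {π' : P' ⟶ c.sigma M'}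
    {γ : P ⟶ P'} {α : M ⟶ M'} (h : (π ≫ c.envδ M) ≫ α⟦(1 : ℤ)⟧' = γ ≫ π' ≫ c.envδ M') :
    c.toSigma π ≫ c.sigmaFunctor.map ((toQuotient 𝕏).map α) =
      (toQuotient 𝕏).map γ ≫ c.toSigma π' := by
  obtain ⟨s, hs⟩ := c.exists_sigmaLift α
  rw [c.sigmaFunctor_map hs]
  obtain ⟨-, -, -, hs⟩ := hs
  change (toQuotient 𝕏).map π ≫ (toQuotient 𝕏).map s = (toQuotient 𝕏).map γ ≫ (toQuotient 𝕏).map π'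
  rw [← Functor.map_comp, ← Functor.map_comp]
  apply c.toQuotient_map_eq_of_comp_envδ
  rw [Category.assoc, Category.assoc, ← hs, ← h, Category.assoc]

/-- Commutative squares between `𝕏`-monomorphisms of the quotient category extend to morphisms of
standard right-triangles. -/
lemma exists_hom_of_isXMono {M N P M' N' P' : T} {μ : M ⟶ N} {ν : N ⟶ P} {δ : P ⟶ M⟦(1 : ℤ)⟧}
    {π : P ⟶ c.sigma M} (hμ : IsXMono 𝕏 μ) (hT : Triangle.mk μ ν δ ∈ distTriang T)
    (hπ : π ≫ c.envδ M = δ) {μ' : M' ⟶ N'} {ν' : N' ⟶ P'} {δ' : P' ⟶ M'⟦(1 : ℤ)⟧}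
    {π' : P' ⟶ c.sigma M'} (hT' : Triangle.mk μ' ν' δ' ∈ distTriang T)
    (hπ' : π' ≫ c.envδ M' = δ') (a : (toQuotient 𝕏).obj M ⟶ (toQuotient 𝕏).obj M')
    (b : (toQuotient 𝕏).obj N ⟶ (toQuotient 𝕏).obj N')
    (hab : (toQuotient 𝕏).map μ ≫ b = a ≫ (toQuotient 𝕏).map μ') :
    ∃ d : (toQuotient 𝕏).obj P ⟶ (toQuotient 𝕏).obj P',
      (toQuotient 𝕏).map ν ≫ d = b ≫ (toQuotient 𝕏).map ν' ∧
      c.toSigma π ≫ c.sigmaFunctor.map a = d ≫ c.toSigma π' := by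
  obtain ⟨α, rfl⟩ := (toQuotient 𝕏).map_surjective a
  obtain ⟨β, rfl⟩ := (toQuotient 𝕏).map_surjective b
  rw [← Functor.map_comp, ← Functor.map_comp, toQuotient_map_eq_iff] at hab
  obtain ⟨X, hX, i, j, hij⟩ := hab
  -- the representative `β` can be changed so that the square commutes in `T`
  obtain ⟨i', rfl⟩ := hμ hX i
  have hβ : (toQuotient 𝕏).map (β - i' ≫ j) = (toQuotient 𝕏).map β := by
    rw [Functor.map_sub, toQuotient_map_eq_zero hX, sub_zero]
  obtain ⟨γ, h₁, h₂⟩ : ∃ γ : P ⟶ P', ν ≫ γ = (β - i' ≫ j) ≫ ν' ∧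
      δ ≫ α⟦(1 : ℤ)⟧' = γ ≫ δ' :=
    complete_distinguished_triangle_morphism _ _ hT hT' α (β - i' ≫ j) (by
      change μ ≫ (β - i' ≫ j) = α ≫ μ'
      rw [Preadditive.comp_sub, ← Category.assoc, hij, sub_sub_cancel])
  refine ⟨(toQuotient 𝕏).map γ, ?_, ?_⟩
  · rw [← hβ, ← Functor.map_comp, ← Functor.map_comp, h₁]
  · apply c.toSigma_comp_sigmaFunctor_map
    rw [hπ, hπ', h₂]

variable {c} in
lemma RightDistinguished.exists_hom {A B D A' B' D' : QuotientCat 𝕏} {f : A ⟶ B} {g : B ⟶ D}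
    {h : D ⟶ c.sigmaFunctor.obj A} {f' : A' ⟶ B'} {g' : B' ⟶ D'}
    {h' : D' ⟶ c.sigmaFunctor.obj A'} (H : c.RightDistinguished f g h)
    (H' : c.RightDistinguished f' g' h') (a : A ⟶ A') (b : B ⟶ B') (hab : f ≫ b = a ≫ f') :
    ∃ d : D ⟶ D', g ≫ d = b ≫ g' ∧ h ≫ c.sigmaFunctor.map a = d ≫ h' := by
  obtain ⟨M, N, P, μ, ν, δ, n, π, hμ, hT, -, -, hπ, i, j, l, h₁, h₂, h₃⟩ := H
  obtain ⟨M', N', P', μ', ν', δ', n', π', -, hT', -, -, hπ', i', j', l', h₁', h₂', h₃'⟩ := H'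
  obtain ⟨d, hd₁, hd₂⟩ := c.exists_hom_of_isXMono hμ hT hπ hT' hπ' (i.inv ≫ a ≫ i'.hom)
    (j.inv ≫ b ≫ j'.hom) (by
      rw [← cancel_epi i.hom, ← reassoc_of% h₁, j.hom_inv_id_assoc, reassoc_of% hab, h₁']
      simp)
  refine ⟨l.hom ≫ d ≫ l'.inv, ?_, ?_⟩
  · rw [reassoc_of% h₂, reassoc_of% hd₁, j.hom_inv_id_assoc, ← Category.assoc, ← Category.assoc,
      Iso.comp_inv_eq, Category.assoc, Category.assoc, h₂']
  · rw [← cancel_mono (c.sigmaFunctor.map i'.hom)]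
    simp only [Category.assoc]
    rw [h₃', l'.inv_hom_id_assoc, ← hd₂, ← reassoc_of% h₃, ← Functor.map_comp, ← Functor.map_comp,
      i.hom_inv_id_assoc]

/-- The right-triangles satisfy the axioms of a pretriangulated category, with rotation in one
direction. -/
lemma isRightTriangulation [IsTriangulated T] [HasShift (QuotientCat 𝕏) ℤ]
    (e : shiftFunctor (QuotientCat 𝕏) (1 : ℤ) ≅ c.sigmaFunctor) :
    IsRightTriangulation (C := QuotientCat 𝕏)
      (fun A _ _ f g h ↦ c.RightDistinguished f g (h ≫ e.hom.app A)) where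
  of_iso X Y Z X' Y' Z' f g h f' g' h' a b d h₁ h₂ h₃ H := H.of_iso a b d h₁ h₂ (by
    rw [Category.assoc, ← e.hom.naturality, reassoc_of% h₃])
  contractible X Z hZ := by
    simpa using c.rightDistinguished_contractible X Z hZ
  exists_cocone X Y f := by
    obtain ⟨D, g, h, H⟩ := c.exists_rightDistinguished f
    exact ⟨D, g, h ≫ e.inv.app X, by simpa using H⟩
  rotate X Y Z f g h H := H.rotate.of_iso (Iso.refl _) (Iso.refl _) (e.app X) (by simp) (by simp)
    (by simp)
  exists_hom X Y Z X' Y' Z' f g h f' g' h' H H' a b hab := by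
    obtain ⟨d, h₁, h₂⟩ := H.exists_hom H' a b hab
    refine ⟨d, h₁, ?_⟩
    rw [← cancel_mono (e.hom.app X'), Category.assoc, Category.assoc, ← h₂, e.hom.naturality,
      Category.assoc]

end ApproximationTriangles

/-- An isomorphism of functors can be descended along a fully faithful functor with its sign
changed. -/
lemma exists_iso_map_eq_neg {C D E : Type*} [Category* C] [Category* D] [Category* E]
    [Preadditive E] {G H : C ⥤ D} {F : D ⥤ E} [F.Full] [F.Faithful] (Φ : G ⋙ F ≅ H ⋙ F) :
    ∃ e : G ≅ H, ∀ A, F.map (e.hom.app A) = -Φ.hom.app A := by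
  let Ψ : G ⋙ F ≅ H ⋙ F :=
    NatIso.ofComponents (fun A ↦
      { hom := -Φ.hom.app A
        inv := -Φ.inv.app A
        hom_inv_id := by simp
        inv_hom_id := by simp })
      (fun f ↦ by rw [Preadditive.comp_neg, Φ.hom.naturality, Preadditive.neg_comp])
  exact ⟨Functor.fullyFaithfulCancelRight F Ψ, fun A ↦ by
    rw [Functor.fullyFaithfulCancelRight_hom_app, Functor.map_preimage]
    rfl⟩

/-! ### The octahedral axiom -/

namespace ApproximationTriangles

variable {T : Type u} [Category.{v} T] [Preadditive T] [HasZeroObject T] [HasShift T ℤ]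
  [∀ n : ℤ, (shiftFunctor T n).Additive] [Pretriangulated T]
  {𝕏 : ObjectProperty T} (c : ApproximationTriangles 𝕏) [IsAdmissible 𝕏]

/-- The octahedral axiom for the right-triangles. It is inherited from the octahedral axiom
of `T`, applied to representatives which are `𝕏`-monomorphisms. -/
lemma isTriangulated_quotient [IsTriangulated T] [HasShift (QuotientCat 𝕏) ℤ]
    [∀ n : ℤ, (shiftFunctor (QuotientCat 𝕏) n).Additive] [Pretriangulated (QuotientCat 𝕏)]
    (e : shiftFunctor (QuotientCat 𝕏) (1 : ℤ) ≅ c.sigmaFunctor)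
    (he : ∀ {A B D : QuotientCat 𝕏} (f : A ⟶ B) (g : B ⟶ D) (h : D ⟶ c.sigmaFunctor.obj A),
      c.RightDistinguished f g h → Triangle.mk f g (h ≫ e.inv.app A) ∈ distTriang _) :
    IsTriangulated (QuotientCat 𝕏) := by
  apply IsTriangulated.mk'
  intro A₁ A₂ A₃ f₁₂ f₂₃
  obtain ⟨M₂, μ₁₂, b₂, hμ₁₂, hf₁₂⟩ := c.exists_isXMono f₁₂
  obtain ⟨M₃, μ₂₃, b₃, hμ₂₃, hf₂₃⟩ := c.exists_isXMono (b₂.inv ≫ f₂₃)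
  change M₂ ⟶ M₃ at μ₂₃
  have hμ₁₃ : IsXMono 𝕏 (μ₁₂ ≫ μ₂₃) := fun X hX g ↦ by
    obtain ⟨g', rfl⟩ := hμ₁₂ hX g
    obtain ⟨g'', rfl⟩ := hμ₂₃ hX g'
    exact ⟨g'', Category.assoc _ _ _⟩
  obtain ⟨P₁₂, ν₁₂, δ₁₂, h₁₂⟩ := distinguished_cocone_triangle μ₁₂
  obtain ⟨P₂₃, ν₂₃, δ₂₃, h₂₃⟩ := distinguished_cocone_triangle μ₂₃
  obtain ⟨P₁₃, ν₁₃, δ₁₃, h₁₃⟩ := distinguished_cocone_triangle (μ₁₂ ≫ μ₂₃)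
  obtain ⟨-, π₁₂, -, -, hπ₁₂⟩ := c.exists_hom_env h₁₂ hμ₁₂
  obtain ⟨-, π₂₃, -, -, hπ₂₃⟩ := c.exists_hom_env h₂₃ hμ₂₃
  obtain ⟨-, π₁₃, -, -, hπ₁₃⟩ := c.exists_hom_env h₁₃ hμ₁₃
  have H₁₂ := he _ _ _ (c.rightDistinguished_of_distinguished h₁₂ hμ₁₂ hπ₁₂)
  have H₂₃ := he _ _ _ (c.rightDistinguished_of_distinguished h₂₃ hμ₂₃ hπ₂₃)
  have H₁₃ := he _ _ _ (c.rightDistinguished_of_distinguished h₁₃ hμ₁₃ hπ₁₃)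
  rw [Functor.map_comp] at H₁₃
  obtain ⟨⟨m₁, m₃, comm₁, comm₂, comm₃, comm₄, mem⟩⟩ :=
    IsTriangulated.octahedron_axiom rfl h₁₂ h₂₃ h₁₃
  have hm₁ : IsXMono 𝕏 m₁ := (isXMono_iff mem 𝕏).2 fun X hX g ↦ by
    rw [Category.assoc, ← Functor.map_comp]
    exact (isXMono_iff h₂₃ 𝕏).1 hμ₂₃ hX _
  obtain ⟨s, hs⟩ := c.exists_sigmaLift ν₁₂
  have hsσ := c.sigmaFunctor_map hs
  obtain ⟨-, -, -, hs⟩ := hs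
  have H := he _ _ _ (c.rightDistinguished_of_distinguished (π := π₂₃ ≫ s) mem hm₁ (by
    rw [Category.assoc, ← hs, reassoc_of% hπ₂₃]))
  refine ⟨(toQuotient 𝕏).obj A₁.as, (toQuotient 𝕏).obj M₂, (toQuotient 𝕏).obj M₃,
    (toQuotient 𝕏).obj P₁₂, (toQuotient 𝕏).obj P₂₃, (toQuotient 𝕏).obj P₁₃,
    (toQuotient 𝕏).map μ₁₂, (toQuotient 𝕏).map μ₂₃, Iso.refl _, b₂, b₃,
    hf₁₂.trans (Category.id_comp _).symm, ?_, (toQuotient 𝕏).map ν₁₂,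
    c.toSigma π₁₂ ≫ e.inv.app _, H₁₂, (toQuotient 𝕏).map ν₂₃, c.toSigma π₂₃ ≫ e.inv.app _, H₂₃,
    (toQuotient 𝕏).map ν₁₃, c.toSigma π₁₃ ≫ e.inv.app _, H₁₃,
    ⟨⟨(toQuotient 𝕏).map m₁, (toQuotient 𝕏).map m₃, ?_, ?_, ?_, ?_, ?_⟩⟩⟩
  · rw [← hf₂₃, Category.assoc, b₂.hom_inv_id_assoc]
  · rw [← Functor.map_comp, ← Functor.map_comp, comm₁]
  · rw [← Category.assoc, c.map_comp_toSigma]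
    congr 1
    apply c.toQuotient_map_eq_of_comp_envδ
    rw [Category.assoc, hπ₁₃, hπ₁₂, comm₂]
  · rw [← Functor.map_comp, comm₃]
  · rw [Category.assoc, ← e.inv.naturality, ← Category.assoc, ← Category.assoc,
      c.toSigma_comp_sigmaFunctor_map (by rw [hπ₁₃, hπ₂₃, comm₄])]
  · convert H using 2
    rw [Category.assoc, ← e.inv.naturality, ← Category.assoc]
    congr 1
    rw [hsσ]
    exact ((toQuotient 𝕏).map_comp _ _).symm

/-! ### The equivalence `σ` and the left-triangles -/

section

variable (h𝕏 : ∀ ⦃M N P : T⦄ (μ : M ⟶ N) (ν : N ⟶ P) (δ : P ⟶ M⟦(1 : ℤ)⟧),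
    Triangle.mk μ ν δ ∈ distTriang T → (IsXMono 𝕏 μ ↔ IsXEpi 𝕏 ν))

include h𝕏

/-- Fullness of `σ`: since `X_N ⟶ σ N` is an `𝕏`-epimorphism, each morphism `σ M ⟶ σ N` is part of a
morphism of the chosen triangles. -/
lemma sigmaFunctor_full : c.sigmaFunctor.Full where
  map_surjective {A B} f := by
    obtain ⟨s, hs⟩ : ∃ s : c.sigma A.as ⟶ c.sigma B.as, (toQuotient 𝕏).map s = f :=
      (toQuotient 𝕏).map_surjective f
    obtain ⟨ξ, hξ⟩ := (h𝕏 _ _ _ (c.env_dist B.as)).1 (c.isPreenvelope _).2 (c.isPreenvelope _).1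
      (c.envπ A.as ≫ s)
    obtain ⟨μ, h₁, h₂⟩ : ∃ μ : A.as ⟶ B.as, c.envι A.as ≫ ξ = μ ≫ c.envι B.as ∧
        c.envδ A.as ≫ μ⟦(1 : ℤ)⟧' = s ≫ c.envδ B.as :=
      complete_distinguished_triangle_morphism₁ _ _ (c.env_dist A.as) (c.env_dist B.as) ξ s hξ.symm
    exact ⟨(toQuotient 𝕏).map μ, (c.sigmaFunctor_map ⟨ξ, h₁, hξ.symm, h₂⟩).trans hs⟩

/-- Faithfulness of `σ`: a morphism `σ M ⟶ σ N` which factors through `𝕏` is killed by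
`σ N ⟶ Σ N`. -/
lemma sigmaFunctor_faithful : c.sigmaFunctor.Faithful where
  map_injective {A B f g} hfg := by
    obtain ⟨μ, rfl⟩ : ∃ μ : A.as ⟶ B.as, (toQuotient 𝕏).map μ = f :=
      (toQuotient 𝕏).map_surjective f
    obtain ⟨μ', rfl⟩ : ∃ μ' : A.as ⟶ B.as, (toQuotient 𝕏).map μ' = g :=
      (toQuotient 𝕏).map_surjective g
    obtain ⟨s, hs⟩ := c.exists_sigmaLift μ
    obtain ⟨s', hs'⟩ := c.exists_sigmaLift μ'
    have hss' := (c.sigmaFunctor_map hs).symm.trans (hfg.trans (c.sigmaFunctor_map hs'))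
    obtain ⟨-, -, -, hs⟩ := hs
    obtain ⟨-, -, -, hs'⟩ := hs'
    obtain ⟨X, hX, a, b, hab⟩ := (toQuotient_map_eq_iff 𝕏 _ _).1 hss'
    have hb : b ≫ c.envδ B.as = 0 := (isXEpi_iff (c.env_dist B.as) 𝕏).1
      ((h𝕏 _ _ _ (c.env_dist B.as)).1 (c.isPreenvelope _).2) hX b
    obtain ⟨r, hr⟩ := exists_of_comp_shift_eq_zero (c.env_dist A.as) (μ - μ') (by
      rw [Functor.map_sub, Preadditive.comp_sub, hs, hs', ← Preadditive.sub_comp, ← hab,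
        Category.assoc, hb, comp_zero])
    exact (toQuotient_map_eq_iff 𝕏 _ _).2 ⟨_, (c.isPreenvelope _).1, _, r, hr⟩

/-- The comparison morphism `N ⟶ σ (ω N)`. It is invertible in the quotient because the precover
triangle of `N` is also a preenvelope triangle of `ω N`. -/
lemma exists_comparison (N : T) :
    ∃ f : N ⟶ c.sigma (c.omega N), f ≫ c.envδ (c.omega N) = c.covδ N ∧
      IsIso ((toQuotient 𝕏).map f) := by
  obtain ⟨-, f, -, -, hf⟩ := c.exists_hom_env (c.cov_dist N)
    ((h𝕏 _ _ _ (c.cov_dist N)).2 (c.isPrecover N).2)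
  obtain ⟨n, hn⟩ := (c.isPreenvelope (c.omega N)).2 (c.isPrecover N).1 (c.covι N)
  obtain ⟨g, -, hg⟩ : ∃ g : c.sigma (c.omega N) ⟶ N, c.envπ (c.omega N) ≫ g = n ≫ c.covπ N ∧
      c.envδ (c.omega N) ≫ (𝟙 (c.omega N))⟦(1 : ℤ)⟧' = g ≫ c.covδ N :=
    complete_distinguished_triangle_morphism _ _ (c.env_dist _) (c.cov_dist N) (𝟙 _) n
      (hn.trans (Category.id_comp _).symm)
  rw [CategoryTheory.Functor.map_id, Category.comp_id] at hg
  refine ⟨f, hf, (toQuotient 𝕏).map g, ?_, ?_⟩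
  · rw [← Functor.map_comp, ← CategoryTheory.Functor.map_id, toQuotient_map_eq_iff]
    obtain ⟨d, hd⟩ := exists_of_comp_eq_zero (c.cov_dist N) (f ≫ g - 𝟙 N) (by
      rw [Preadditive.sub_comp, Category.assoc, ← hg, hf, Category.id_comp, sub_self])
    exact ⟨_, (c.isPrecover N).1, d, _, hd⟩
  · rw [← Functor.map_comp, ← CategoryTheory.Functor.map_id]
    apply c.toQuotient_map_eq_of_comp_envδ
    rw [Category.assoc, hf, ← hg, Category.id_comp]

/-- The natural isomorphism `𝟭 ≅ ω ⋙ σ`. -/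
lemma exists_comparisonIso : ∃ κ : 𝟭 (QuotientCat 𝕏) ≅ c.omegaFunctor ⋙ c.sigmaFunctor,
    ∀ N : T, ∃ f : N ⟶ c.sigma (c.omega N), f ≫ c.envδ (c.omega N) = c.covδ N ∧
      κ.hom.app ((toQuotient 𝕏).obj N) = (toQuotient 𝕏).map f := by
  choose f hf hf' using c.exists_comparison h𝕏
  refine ⟨NatIso.ofComponents (fun A ↦ (asIso ((toQuotient 𝕏).map (f A.as)) :
    (toQuotient 𝕏).obj A.as ≅ (toQuotient 𝕏).obj (c.sigma (c.omega A.as)))) ?_,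
    fun N ↦ ⟨f N, hf N, rfl⟩⟩
  intro A B φ
  obtain ⟨μ, rfl⟩ : ∃ μ : A.as ⟶ B.as, (toQuotient 𝕏).map μ = φ :=
    (toQuotient 𝕏).map_surjective φ
  obtain ⟨t, ht⟩ := c.exists_omegaLift μ
  obtain ⟨s, hs⟩ := c.exists_sigmaLift t
  have h : (c.omegaFunctor ⋙ c.sigmaFunctor).map ((toQuotient 𝕏).map μ) = (toQuotient 𝕏).map s :=
    (congrArg _ (c.omegaFunctor_map ht)).trans (c.sigmaFunctor_map hs)
  rw [h]
  change (toQuotient 𝕏).map μ ≫ (toQuotient 𝕏).map (f B.as) =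
    (toQuotient 𝕏).map (f A.as) ≫ (toQuotient 𝕏).map s
  rw [← Functor.map_comp, ← Functor.map_comp]
  apply c.toQuotient_map_eq_of_comp_envδ
  obtain ⟨-, -, -, ht⟩ := ht
  obtain ⟨-, -, -, hs⟩ := hs
  rw [Category.assoc, Category.assoc, hf, ← hs, reassoc_of% (hf A.as), ht]

lemma sigmaFunctor_isEquivalence : c.sigmaFunctor.IsEquivalence := by
  have := c.sigmaFunctor_full h𝕏
  have := c.sigmaFunctor_faithful h𝕏
  obtain ⟨κ, -⟩ := c.exists_comparisonIso h𝕏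
  have : c.sigmaFunctor.EssSurj := ⟨fun A ↦ ⟨c.omegaFunctor.obj A, ⟨(κ.app A).symm⟩⟩⟩
  exact {}

/-- The left-triangles are the right-triangles read backwards. -/
lemma leftDistinguished_iff {κ : 𝟭 (QuotientCat 𝕏) ≅ c.omegaFunctor ⋙ c.sigmaFunctor}
    (hκ : ∀ N : T, ∃ f : N ⟶ c.sigma (c.omega N), f ≫ c.envδ (c.omega N) = c.covδ N ∧
      κ.hom.app ((toQuotient 𝕏).obj N) = (toQuotient 𝕏).map f)
    {A B D : QuotientCat 𝕏} (f : c.omegaFunctor.obj D ⟶ A) (g : A ⟶ B) (h : B ⟶ D) :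
    c.LeftDistinguished f g h ↔
      c.RightDistinguished g h (κ.hom.app D ≫ c.sigmaFunctor.map f) := by
  have key : ∀ {L N : T} (π : c.omega N ⟶ L) (ρ : N ⟶ c.sigma L),
      ρ ≫ c.envδ L = c.covδ N ≫ π⟦(1 : ℤ)⟧' →
      κ.hom.app ((toQuotient 𝕏).obj N) ≫ c.sigmaFunctor.map (c.fromOmega π) = c.toSigma ρ := by
    intro L N π ρ hρ
    obtain ⟨φ, hφ, hφ'⟩ := hκ N
    have h₁ := c.toSigma_comp_sigmaFunctor_map (π := φ) (π' := ρ) (γ := 𝟙 N) (α := π) (by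
      rw [hφ, hρ, Category.id_comp])
    rw [CategoryTheory.Functor.map_id, Category.id_comp] at h₁
    rw [hφ']
    exact h₁
  have := c.sigmaFunctor_faithful h𝕏
  constructor
  · rintro ⟨L, M, N, l, μ, δ, n, π, hμ, hT, hn, hl, hπ, a, b, d, h₁, h₂, h₃⟩
    have hl' := (h𝕏 _ _ _ hT).2 hμ
    obtain ⟨-, ρ, -, -, hρ⟩ := c.exists_hom_env hT hl'
    refine (c.rightDistinguished_of_distinguished hT hl' hρ).of_iso a b d h₂ h₃ ?_
    rw [Category.assoc, ← Functor.map_comp, h₁, Functor.map_comp, ← key π ρ (hρ.trans hπ.symm)]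
    exact (κ.hom.naturality_assoc d.hom _).symm
  · rintro ⟨M, N, P, μ, ν, δ, n, ρ, hμ, hT, hn, hν, hρ, a, b, d, h₁, h₂, h₃⟩
    have hν' := (h𝕏 _ _ _ hT).1 hμ
    obtain ⟨m, π, hm, hl, hπ⟩ := c.exists_hom_cov hT hν'
    refine ⟨M, N, P, μ, ν, δ, m, π, hν', hT, hm, hl, hπ, a, b, d, ?_, h₁, h₂⟩
    apply c.sigmaFunctor.map_injective
    rw [← cancel_epi (κ.hom.app D), Functor.map_comp, Functor.map_comp, ← Category.assoc, h₃,
      ← key π ρ (hρ.trans hπ.symm)]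
    exact κ.hom.naturality_assoc d.hom _

/-- If `𝕏`-monomorphisms and `𝕏`-epimorphisms correspond to each other in distinguished
triangles, then the pretriangulated structure of the quotient is a triangulated structure. -/
lemma isTriangulatedStructure [IsTriangulated T] :
    c.pretriangulatedData.IsTriangulatedStructure := by
  have := c.sigmaFunctor_isEquivalence h𝕏
  obtain ⟨κ, hκ⟩ := c.exists_comparisonIso h𝕏
  obtain ⟨_, ⟨e⟩⟩ := exists_hasShift_of_isEquivalence c.sigmaFunctor
  have add : ∀ n : ℤ, (shiftFunctor (QuotientCat 𝕏) n).Additive := fun n ↦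
    Functor.additive_of_preserves_binary_products _
  let _ : Pretriangulated (QuotientCat 𝕏) := (c.isRightTriangulation e).pretriangulated
  have hr : ∀ {A B D : QuotientCat 𝕏} (f : A ⟶ B) (g : B ⟶ D) (h : D ⟶ c.sigmaFunctor.obj A),
      c.RightDistinguished f g h ↔ Triangle.mk f g (h ≫ e.inv.app A) ∈ distTriang _ := by
    intro A B D f g h
    change _ ↔ c.RightDistinguished f g ((h ≫ e.inv.app A) ≫ e.hom.app A)
    rw [Category.assoc, e.inv_hom_id_app, Category.comp_id]
  -- the sign of the rotation is absorbed by the identification of `⟦-1⟧` with `ω`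
  let ε : shiftFunctor (QuotientCat 𝕏) (-1 : ℤ) ⋙ shiftFunctor (QuotientCat 𝕏) (1 : ℤ) ≅ 𝟭 _ :=
    (shiftEquiv (QuotientCat 𝕏) (1 : ℤ)).counitIso
  let Φ : shiftFunctor (QuotientCat 𝕏) (-1 : ℤ) ⋙ shiftFunctor (QuotientCat 𝕏) (1 : ℤ) ≅
      c.omegaFunctor ⋙ shiftFunctor (QuotientCat 𝕏) (1 : ℤ) :=
    ε ≪≫ κ ≪≫ Functor.isoWhiskerLeft c.omegaFunctor e.symm
  obtain ⟨e', he'⟩ := exists_iso_map_eq_neg Φ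
  have hΦ : ∀ D : QuotientCat 𝕏, Φ.hom.app D =
      ε.hom.app D ≫ κ.hom.app D ≫ e.inv.app (c.omegaFunctor.obj D) := fun _ ↦ rfl
  have hl : ∀ {A B D : QuotientCat 𝕏} (f : c.omegaFunctor.obj D ⟶ A) (g : A ⟶ B) (h : B ⟶ D),
      c.LeftDistinguished f g h ↔
        Triangle.mk (e'.hom.app D ≫ f) g (h ≫ ε.inv.app D) ∈ distTriang _ := by
    intro A B D f g h
    have h₃ : -(e'.hom.app D ≫ f)⟦(1 : ℤ)⟧' =
        (ε.app D).hom ≫ (κ.hom.app D ≫ c.sigmaFunctor.map f) ≫ e.inv.app A := by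
      have := e.inv.naturality f
      rw [Functor.map_comp, he', hΦ, Preadditive.neg_comp, neg_neg, Category.assoc,
        Category.assoc, Category.assoc]
      congr 2
      exact this.symm
    refine (c.leftDistinguished_iff h𝕏 hκ f g h).trans ((hr _ _ _).trans
      (Iff.trans ?_ distinguished_rotate_iff.symm))
    rw [h₃]
    constructor
    · exact distinguished_of_iso (Iso.refl _) (Iso.refl _) (ε.app D) (by simp) (by simp) (by simp)
    · exact distinguished_of_iso (Iso.refl _) (Iso.refl _) (ε.app D).symm (by simp) (by simp)
        (by simp)
  exact ⟨inferInstance, add, inferInstance, c.isTriangulated_quotient e fun f g h ↦ (hr f g h).1,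
    e, e', hr, hl⟩

end

end ApproximationTriangles

end QuotientTriangulation

/-- Let `T` be a Hom-finite `k`-linear triangulated category with split idempotents and Serre
functor `S` over an algebraically closed field `k`, and let `𝕏` be a class of objects closed under
isomorphisms, direct sums and direct summands which is precovering and preenveloping. Then the
pretriangulated structure of the quotient category `T_𝕏` (for any choice of approximation
triangles) is a triangulated structure if and only if `τ 𝕏 = 𝕏`. -/
theorem mainTheorem1 {k : Type w} [Field k] [IsAlgClosed k]
    {T : Type u} [Category.{v} T] [Preadditive T] [Linear k T] [HasZeroObject T] [HasShift T ℤ]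
    [∀ n : ℤ, (shiftFunctor T n).Additive]
    [Pretriangulated T] [IsTriangulated T]
    [IsIdempotentComplete T] [∀ A B : T, FiniteDimensional k (A ⟶ B)]
    (S : QuotientTriangulation.SerreFunctor k T)
    (𝕏 : ObjectProperty T) [QuotientTriangulation.IsAdmissible 𝕏]
    (c : QuotientTriangulation.ApproximationTriangles 𝕏) :
    c.pretriangulatedData.IsTriangulatedStructure ↔ 𝕏.map S.tau = 𝕏 :=
  ⟨fun hc ↦ QuotientTriangulation.ApproximationTriangles.map_tau_eq_of_isTriangulatedStructure hc S,
    fun h ↦ c.isTriangulatedStructure fun _ _ _ _ _ _ hT ↦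
      QuotientTriangulation.isXMono_iff_isXEpi hT S 𝕏 h⟩
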